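/- **Setting.** Let $1\le k<n$, $q\ge 1$, let $X$ be a real $n\times k$ matrix of rank $k$, $R$ a real $q\times k$ matrix of rank $q$, $r\in\mathbb R^q$. Put $\mathfrak M=\operatorname{span}(X)$, $\mathfrak M_0=\{X\beta: R\beta=r\}$, $\mathfrak M_1=\mathfrak M\setminus\mathfrak M_0$. Let $P_{\mu,\Phi}$ be the Gaussian law on $\mathbb R^n$ with mean $\mu$ and covariance matrix $\Phi$, let $\Lambda(\rho)=(\rho^{|i-j|})_{i,j=1}^n$, and let $\mathfrak C$ be a set of symmetric positive definite $n\times n$ matrices that contains $\mathfrak C_{AR(1)}=\{\Lambda(\rho):-1<\rho<1\}$. The null hypothesis is $\mu\in\mathfrak M_0$, the alternative is $\mu\in\mathfrak M_1$ (in both cases with $0<\sigma^2<\infty$, $\Sigma\in\mathfrak C$), under observations with law $P_{\mu,\sigma^2\Sigma}$. The size of a test with rejection region $W$ is $\sup_{\mu_0\in\mathfrak M_0}\sup_{0<\sigma^2<\infty}\sup_{\Sigma\in\mathfrak C}P_{\mu_0,\sigma^2\Sigma}(W)$, its infimal power is $\inf_{\mu_1\in\mathfrak M_1}\inf_{0<\sigma^2<\infty}\inf_{\Sigma\in\mathfrak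 C}P_{\mu_1,\sigma^2\Sigma}(W)$, and it is biased if its rejection probability at some point of the alternative is smaller than its size. Let $e_+=(1,\dots,1)'$ and $e_-=(-1,1,\dots,(-1)^n)'$. Let $\hat\beta(y)=(X'X)^{-1}X'y$, $\hat u(y)=y-X\hat\beta(y)$, $\hat\sigma^2(y)=(n-k)^{-1}\hat u(y)'\hat u(y)$. Let $a_1\in\{1,2\}$, $a_2\in\{n-1,n\}$ with $k\le a_2-a_1$, and $$\hat\rho(y)=\sum_{t=2}^n\hat u_t(y)\hat u_{t-1}(y)\Big/\sum_{t=a_1}^{a_2}\hat u_t^2(y)\qquad (y\notin N_0),\qquad N_0=\Big\{y:\sum_{t=a_1}^{a_2}\hat u_t^2(y)=0\Big\}.$$ For $a_1=1,a_2=n$ this is the Yule–Walker estimator $\hat\rho_{YW}$. Let $N_1=\{y:|\sum_{t=2}^n\hat u_t(y)\hat u_{t-1}(y)|=\sum_{t=a_1}^{a_2}\hat u_t^2(y)\}$ and $$\mathbb R^n\setminus N_2=\{y\notin N_1:\det(X'\Lambda^{-1}(\hat\rho(y))X)\ne0\}.$$ For $y\notin N_2$ let $\tilde\beta(y)=(X'\Lambda^{-1}(\hat\rho(y))X)^{-1}X'\Lambda^{-1}(\hat\rho(y))y$,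 $\tilde\sigma^2(y)=(n-k)^{-1}(y-X\tilde\beta(y))'\Lambda^{-1}(\hat\rho(y))(y-X\tilde\beta(y))$, $\tilde\Omega(y)=\tilde\sigma^2(y)R(X'\Lambda^{-1}(\hat\rho(y))X)^{-1}R'$, and let $$\mathbb R^n\setminus N_2^*=\{y\notin N_2:\tilde\sigma^2(y)\neq0,\ \det(R(X'\Lambda^{-1}(\hat\rho(y))X)^{-1}R')\ne0\}.$$ For $y\notin N_0$ let $\hat\Omega(y)=\hat\sigma^2(y)R(X'X)^{-1}X'\Lambda(\hat\rho(y))X(X'X)^{-1}R'$, and let $$\mathbb R^n\setminus N_0^*=\{y\notin N_0:\det(R(X'X)^{-1}X'\Lambda(\hat\rho(y))X(X'X)^{-1}R')\ne0\}.$$ The test statistics are $T_{FGLS}(y)=(R\tilde\beta(y)-r)'\tilde\Omega^{-1}(y)(R\tilde\beta(y)-r)$ for $y\notin N_2^*$ and $T_{FGLS}(y)=0$ otherwise; $T_{OLS}(y)=(R\hat\beta(y)-r)'\hat\Omega^{-1}(y)(R\hat\beta(y)-r)$ for $y\notin N_0^*$ and $T_{OLS}(y)=0$ otherwise. **Theorem.**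 Let $(T,N^*)$ be either $(T_{FGLS},N_2^*)$ or $(T_{OLS},N_0^*)$, let $e$ be either $e_+$ or $e_-$, let $0<C<\infty$ and $W(C)=\{y\in\mathbb R^n:T(y)\ge C\}$. 1. Suppose $e\notin N^*$ and $T(e+\mu_0^*)>C$ for some (equivalently, all) $\mu_0^*\in\mathfrak M_0$. Then $\sup_{\Sigma\in\mathfrak C}P_{\mu_0,\sigma^2\Sigma}(W(C))=1$ for every $\mu_0\in\mathfrak M_0$ and $0<\sigma^2<\infty$. In particular, the size of the test equals one. 2. Suppose $e\notin N^*$ and $T(e+\mu_0^*)<C$ for some (equivalently, all) $\mu_0^*\in\mathfrak M_0$. Then $\inf_{\Sigma\in\mathfrak C}P_{\mu_0,\sigma^2\Sigma}(W(C))=0$ for every $\mu_0\in\mathfrak M_0$ and $0<\sigma^2<\infty$; $\inf_{\mu_1\in\mathfrak M_1}\inf_{\Sigma\in\mathfrak C}P_{\mu_1,\sigma^2\Sigma}(W(C))=0$ for every $0<\sigma^2<\infty$; the test is biased; $\inf_{0<\sigma^2<\infty}\inf_{\Sigma\in\mathfrak C}P_{\mu_1,\sigma^2\Sigma}(W(C))=0$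 for every $\mu_1\in\mathfrak M_1$; and the infimal power of the test is zero. 3. Suppose $e\in\mathfrak M$ and $R\hat\beta(e)\ne0$. Then there is a constant $K(e)$ which, for the given choice of the statistic and of $(a_1,a_2)$, depends only on $e$, $R$ and $X$ (in particular not on $r$, $\mathfrak C$, $C$, $\mu_0$, $\sigma$, $M$), such that for every $\mu_0\in\mathfrak M_0$, $0<\sigma<\infty$ and $M\ge0$ $$\inf_{\gamma\in\mathbb R,|\gamma|\ge M}\ \inf_{\Sigma\in\mathfrak C}P_{\mu_0+\gamma e,\sigma^2\Sigma}(W(C))\ \le\ K(e)\ \le\ \sup_{\Sigma\in\mathfrak C}P_{\mu_0,\sigma^2\Sigma}(W(C)),$$ where $\mu_0+\gamma e\in\mathfrak M_1$ for all $\gamma\ne0$. Furthermore, if $\hat\rho$ coincides with $\hat\rho_{YW}$ on $\mathbb R^n\setminus N_0$ (in particular if $a_1=1$, $a_2=n$), then $K(e)=1$ and hence $\sup_{\Sigma\in\mathfrak C}P_{\mu_0,\sigma^2\Sigma}(W(C))=1$ for every $\mu_0\in\mathfrak M_0$ and $0<\sigma^2<\infty$. -/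

import Mathlib

open MeasureTheory ProbabilityTheory Matrix
open scoped ENNReal NNReal

noncomputable section

namespace AutocorrTest

/-- The Gaussian law `P_{μ,Φ}` on `ℝⁿ` with mean `μ` and covariance matrix `Φ`. -/
def gaussianLaw {n : ℕ} (μ : Fin n → ℝ) (Φ : Matrix (Fin n) (Fin n) ℝ) : Measure (Fin n → ℝ) :=
  (multivariateGaussian (WithLp.toLp 2 μ) Φ).map (fun x => WithLp.ofLp x)

/-- The AR(1) correlation matrix `Λ(ρ)`, with entries `ρ ^ |i - j|` (and `0 ^ 0 = 1`). -/
def arMatrix (n : ℕ) (ρ : ℝ) : Matrix (Fin n) (Fin n) ℝ :=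
  Matrix.of fun i j => ρ ^ ((i : ℤ) - (j : ℤ)).natAbs

/-- The covariance model of all stationary AR(1) correlation matrices. -/
def arModel (n : ℕ) : Set (Matrix (Fin n) (Fin n) ℝ) :=
  {S | ∃ ρ : ℝ, -1 < ρ ∧ ρ < 1 ∧ S = arMatrix n ρ}

/-- `e₊ = (1, …, 1)'`. -/
def ePlus (n : ℕ) : Fin n → ℝ := fun _ => 1

/-- `e₋ = (-1, 1, …, (-1)ⁿ)'`; the index `i : Fin n` stands for the time point `i + 1`. -/
def eMinus (n : ℕ) : Fin n → ℝ := fun i => (-1) ^ ((i : ℕ) + 1)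

section Model

variable {n k q : ℕ}

/-- `𝔐 = span(X)`, the column space of the design matrix. -/
def meanSpace (X : Matrix (Fin n) (Fin k) ℝ) : Set (Fin n → ℝ) :=
  {μ | ∃ β : Fin k → ℝ, μ = X *ᵥ β}

/-- `𝔐₀`, the mean vectors `X β` with `R β = r`. -/
def nullMeans (X : Matrix (Fin n) (Fin k) ℝ) (R : Matrix (Fin q) (Fin k) ℝ) (r : Fin q → ℝ) :
    Set (Fin n → ℝ) :=
  {μ | ∃ β : Fin k → ℝ, μ = X *ᵥ β ∧ R *ᵥ β = r}

/-- `𝔐₁ = 𝔐 \ 𝔐₀`. -/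
def altMeans (X : Matrix (Fin n) (Fin k) ℝ) (R : Matrix (Fin q) (Fin k) ℝ) (r : Fin q → ℝ) :
    Set (Fin n → ℝ) :=
  meanSpace X \ nullMeans X R r

/-- The OLS estimator `(X'X)⁻¹ X' y`. -/
def betaHat (X : Matrix (Fin n) (Fin k) ℝ) (y : Fin n → ℝ) : Fin k → ℝ :=
  (Xᵀ * X)⁻¹ *ᵥ (Xᵀ *ᵥ y)

/-- The OLS residual vector. -/
def resid (X : Matrix (Fin n) (Fin k) ℝ) (y : Fin n → ℝ) : Fin n → ℝ :=
  y - X *ᵥ betaHat X y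

/-- `∑_{t=2}^n û_t û_{t-1}`. -/
def lagSum (X : Matrix (Fin n) (Fin k) ℝ) (y : Fin n → ℝ) : ℝ :=
  ∑ i : Fin n, ∑ j : Fin n, if (i : ℕ) = (j : ℕ) + 1 then resid X y i * resid X y j else 0

/-- `∑_{t=a₁}^{a₂} û_t²`; the index `i : Fin n` stands for the time point `t = i + 1`. -/
def sqSum (X : Matrix (Fin n) (Fin k) ℝ) (a₁ a₂ : ℕ) (y : Fin n → ℝ) : ℝ :=
  ∑ i : Fin n, if a₁ ≤ (i : ℕ) + 1 ∧ (i : ℕ) + 1 ≤ a₂ then resid X y i ^ 2 else 0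

/-- `N₀(a₁,a₂)`, where the estimator of the autoregressive parameter is undefined. -/
def N0 (X : Matrix (Fin n) (Fin k) ℝ) (a₁ a₂ : ℕ) : Set (Fin n → ℝ) :=
  {y | sqSum X a₁ a₂ y = 0}

/-- The estimator `ρ̂` of the autoregressive parameter. It is meaningful only off `N₀(a₁,a₂)`, and
everything below uses it only there. -/
def rhoHat (X : Matrix (Fin n) (Fin k) ℝ) (a₁ a₂ : ℕ) (y : Fin n → ℝ) : ℝ :=
  lagSum X y / sqSum X a₁ a₂ y

/-- The Yule-Walker estimator. -/
def rhoYW (X : Matrix (Fin n) (Fin k) ℝ) (y : Fin n → ℝ) : ℝ := rhoHat X 1 n y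

/-- `Λ(ρ̂(y))`. -/
def lambdaHat (X : Matrix (Fin n) (Fin k) ℝ) (a₁ a₂ : ℕ) (y : Fin n → ℝ) :
    Matrix (Fin n) (Fin n) ℝ :=
  arMatrix n (rhoHat X a₁ a₂ y)

/-- `N₁(a₁,a₂)`, where `ρ̂` is undefined or equal to one in modulus. -/
def N1 (X : Matrix (Fin n) (Fin k) ℝ) (a₁ a₂ : ℕ) : Set (Fin n → ℝ) :=
  {y | |lagSum X y| = sqSum X a₁ a₂ y}

/-- `X' Λ⁻¹(ρ̂(y)) X`. -/
def glsGram (X : Matrix (Fin n) (Fin k) ℝ) (a₁ a₂ : ℕ) (y : Fin n → ℝ) :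
    Matrix (Fin k) (Fin k) ℝ :=
  Xᵀ * (lambdaHat X a₁ a₂ y)⁻¹ * X

/-- `N₂(a₁,a₂)`. -/
def N2 (X : Matrix (Fin n) (Fin k) ℝ) (a₁ a₂ : ℕ) : Set (Fin n → ℝ) :=
  {y | y ∉ N1 X a₁ a₂ ∧ (glsGram X a₁ a₂ y).det ≠ 0}ᶜ

/-- The feasible GLS estimator `β̃`. -/
def betaTilde (X : Matrix (Fin n) (Fin k) ℝ) (a₁ a₂ : ℕ) (y : Fin n → ℝ) : Fin k → ℝ :=
  (glsGram X a₁ a₂ y)⁻¹ *ᵥ (Xᵀ *ᵥ ((lambdaHat X a₁ a₂ y)⁻¹ *ᵥ y))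

/-- `σ̃²`. -/
def sigmaTildeSq (X : Matrix (Fin n) (Fin k) ℝ) (a₁ a₂ : ℕ) (y : Fin n → ℝ) : ℝ :=
  ((n : ℝ) - (k : ℝ))⁻¹ *
    ((y - X *ᵥ betaTilde X a₁ a₂ y) ⬝ᵥ
      ((lambdaHat X a₁ a₂ y)⁻¹ *ᵥ (y - X *ᵥ betaTilde X a₁ a₂ y)))

/-- `R (X' Λ⁻¹(ρ̂(y)) X)⁻¹ R'`. -/
def glsShape (X : Matrix (Fin n) (Fin k) ℝ) (R : Matrix (Fin q) (Fin k) ℝ) (a₁ a₂ : ℕ)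
    (y : Fin n → ℝ) : Matrix (Fin q) (Fin q) ℝ :=
  R * (glsGram X a₁ a₂ y)⁻¹ * Rᵀ

/-- `Ω̃`. -/
def omegaTilde (X : Matrix (Fin n) (Fin k) ℝ) (R : Matrix (Fin q) (Fin k) ℝ) (a₁ a₂ : ℕ)
    (y : Fin n → ℝ) : Matrix (Fin q) (Fin q) ℝ :=
  sigmaTildeSq X a₁ a₂ y • glsShape X R a₁ a₂ y

/-- `N₂*(a₁,a₂)`, the exceptional set of the feasible GLS test. -/
def N2star (X : Matrix (Fin n) (Fin k) ℝ) (R : Matrix (Fin q) (Fin k) ℝ) (a₁ a₂ : ℕ) :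
    Set (Fin n → ℝ) :=
  {y | y ∉ N2 X a₁ a₂ ∧ sigmaTildeSq X a₁ a₂ y ≠ 0 ∧ (glsShape X R a₁ a₂ y).det ≠ 0}ᶜ

open Classical in
/-- The feasible GLS test statistic. -/
def tFGLS (X : Matrix (Fin n) (Fin k) ℝ) (R : Matrix (Fin q) (Fin k) ℝ) (r : Fin q → ℝ)
    (a₁ a₂ : ℕ) (y : Fin n → ℝ) : ℝ :=
  if y ∈ N2star X R a₁ a₂ then 0 else
    (R *ᵥ betaTilde X a₁ a₂ y - r) ⬝ᵥ
      ((omegaTilde X R a₁ a₂ y)⁻¹ *ᵥ (R *ᵥ betaTilde X a₁ a₂ y - r))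

/-- `σ̂²`. -/
def sigmaHatSq (X : Matrix (Fin n) (Fin k) ℝ) (y : Fin n → ℝ) : ℝ :=
  ((n : ℝ) - (k : ℝ))⁻¹ * (resid X y ⬝ᵥ resid X y)

/-- `R (X'X)⁻¹ X' Λ(ρ̂(y)) X (X'X)⁻¹ R'`. -/
def olsShape (X : Matrix (Fin n) (Fin k) ℝ) (R : Matrix (Fin q) (Fin k) ℝ) (a₁ a₂ : ℕ)
    (y : Fin n → ℝ) : Matrix (Fin q) (Fin q) ℝ :=
  R * (Xᵀ * X)⁻¹ * Xᵀ * lambdaHat X a₁ a₂ y * X * (Xᵀ * X)⁻¹ * Rᵀ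

/-- `Ω̂`. -/
def omegaHat (X : Matrix (Fin n) (Fin k) ℝ) (R : Matrix (Fin q) (Fin k) ℝ) (a₁ a₂ : ℕ)
    (y : Fin n → ℝ) : Matrix (Fin q) (Fin q) ℝ :=
  sigmaHatSq X y • olsShape X R a₁ a₂ y

/-- `N₀*(a₁,a₂)`, the exceptional set of the OLS-based test. -/
def N0star (X : Matrix (Fin n) (Fin k) ℝ) (R : Matrix (Fin q) (Fin k) ℝ) (a₁ a₂ : ℕ) :
    Set (Fin n → ℝ) :=
  {y | y ∉ N0 X a₁ a₂ ∧ (olsShape X R a₁ a₂ y).det ≠ 0}ᶜ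

open Classical in
/-- The OLS-based test statistic. -/
def tOLS (X : Matrix (Fin n) (Fin k) ℝ) (R : Matrix (Fin q) (Fin k) ℝ) (r : Fin q → ℝ)
    (a₁ a₂ : ℕ) (y : Fin n → ℝ) : ℝ :=
  if y ∈ N0star X R a₁ a₂ then 0 else
    (R *ᵥ betaHat X y - r) ⬝ᵥ ((omegaHat X R a₁ a₂ y)⁻¹ *ᵥ (R *ᵥ betaHat X y - r))

/-- The two kinds of tests. -/
inductive TestKind : Type
  | fgls
  | ols

/-- The test statistic of the test of the given kind. -/
def stat (κ : TestKind) (X : Matrix (Fin n) (Fin k) ℝ) (R : Matrix (Fin q) (Fin k) ℝ)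
    (r : Fin q → ℝ) (a₁ a₂ : ℕ) : (Fin n → ℝ) → ℝ :=
  match κ with
  | .fgls => tFGLS X R r a₁ a₂
  | .ols => tOLS X R r a₁ a₂

/-- The exceptional set of the test of the given kind. -/
def excSet (κ : TestKind) (X : Matrix (Fin n) (Fin k) ℝ) (R : Matrix (Fin q) (Fin k) ℝ)
    (a₁ a₂ : ℕ) : Set (Fin n → ℝ) :=
  match κ with
  | .fgls => N2star X R a₁ a₂
  | .ols => N0star X R a₁ a₂

/-- The rejection region `{y : T(y) ≥ C}`. -/
def rejRegion (κ : TestKind) (X : Matrix (Fin n) (Fin k) ℝ) (R : Matrix (Fin q) (Fin k) ℝ)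
    (r : Fin q → ℝ) (a₁ a₂ : ℕ) (C : ℝ) : Set (Fin n → ℝ) :=
  {y | C ≤ stat κ X R r a₁ a₂ y}

/-- The size of the test with rejection region `W`: the supremum of the rejection probabilities
under the null hypothesis. -/
def size (X : Matrix (Fin n) (Fin k) ℝ) (R : Matrix (Fin q) (Fin k) ℝ) (r : Fin q → ℝ)
    (𝔠 : Set (Matrix (Fin n) (Fin n) ℝ)) (W : Set (Fin n → ℝ)) : ℝ≥0∞ :=
  ⨆ μ₀ ∈ nullMeans X R r, ⨆ (σ : ℝ) (_ : 0 < σ), ⨆ S ∈ 𝔠, gaussianLaw μ₀ (σ ^ 2 • S) W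

/-- The infimal power of the test with rejection region `W`: the infimum of the rejection
probabilities under the alternative. -/
def infPower (X : Matrix (Fin n) (Fin k) ℝ) (R : Matrix (Fin q) (Fin k) ℝ) (r : Fin q → ℝ)
    (𝔠 : Set (Matrix (Fin n) (Fin n) ℝ)) (W : Set (Fin n → ℝ)) : ℝ≥0∞ :=
  ⨅ μ₁ ∈ altMeans X R r, ⨅ (σ : ℝ) (_ : 0 < σ), ⨅ S ∈ 𝔠, gaussianLaw μ₁ (σ ^ 2 • S) W

/-- The test with rejection region `W` is biased: somewhere in the alternative its power is smaller
than its size. -/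
def IsBiased (X : Matrix (Fin n) (Fin k) ℝ) (R : Matrix (Fin q) (Fin k) ℝ) (r : Fin q → ℝ)
    (𝔠 : Set (Matrix (Fin n) (Fin n) ℝ)) (W : Set (Fin n → ℝ)) : Prop :=
  ∃ μ₁ ∈ altMeans X R r, ∃ σ : ℝ, 0 < σ ∧ ∃ S ∈ 𝔠,
    gaussianLaw μ₁ (σ ^ 2 • S) W < size X R r 𝔠 W

end Model

end AutocorrTest

end

open scoped Topology

noncomputable section

namespace AutocorrTest

/-! ### The AR(1) correlation matrix -/

/-! As ρ tends to ±1 the matrix Λ(ρ) tends to ee', so the Gaussian laws collapse onto lines parallel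
to e, and the rejection probability is governed by the statistic T near such a line. To obtain
pointwise limits, all laws are realised on one space of standard normal innovations ξ: the sample is
μ + σ F ξ, where F is a square root of Λ(±ρ(t)) that tends, as t → 0, to the map ξ ↦ ξ₁ e
(`arFactor_mulVec`, `gaussianLaw_apply`). Almost sure eventual decisions then give limits of
probabilities (`tendsto_gaussianLaw`).

If e is not exceptional, T is continuous at σ ξ₁ e + μ₀ for almost every ξ. Equivariance of the
estimators (`stat_smul_add`) shows that its value there is T(e + μ₀), whatever ξ₁ ≠ 0. Comparison
with C gives the limit 1 or 0. The limit persists for means converging to μ₀, hence for nearby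
alternatives, and by dilation about μ₀ for a fixed alternative with σ → ∞. Bias follows because the
size is positive (`size_rejRegion_pos`).

If e = Xδ, the limiting sample has zero residuals and the first-order limit is useless. The next
order is used: F ξ = ξ₁ e + c(t) w, where w converges to a limit w₀(ξ). By equivariance T depends on
the sample through w and the scalar g = (γ + σ ξ₁)/(σ c(t)), and T/g² converges to the quadratic
form of the weight matrix at w₀ evaluated at Rδ. As |g| → ∞, its sign decides between rejection and
acceptance, so the limit is K = P(form > 0), both for γ = 0 and for γ → ∞. These two choices give
the two inequalities (`tendsto_gaussianLaw_dominantSet`).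

Almost surely w₀ is not exceptional and the form is not zero: the quantities involved are rational
in ξ off a null set, and they do not vanish on the nonempty open set where |ρ̂| < 1, since
everything is positive definite there (`GenRat.ae_ne_zero`, `statSet_nonempty`). The Yule-Walker
estimator always satisfies |ρ̂| < 1, hence K = 1 in that case. -/

/-- The unit lower triangular matrix with entries `ρ ^ (i - j)`. -/
def arLower (n : ℕ) (ρ : ℝ) : Matrix (Fin n) (Fin n) ℝ :=
  Matrix.of fun i j => if (j : ℕ) ≤ i then ρ ^ ((i : ℕ) - j) else 0

/-- The innovation variances `1, 1 - ρ², …, 1 - ρ²`. -/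
def arInnov (n : ℕ) (ρ : ℝ) : Fin n → ℝ := fun j => if (j : ℕ) = 0 then 1 else 1 - ρ ^ 2

/-- Stationarity: one step of the recursion turns the variance 1 into ρ² · 1 + (1 - ρ²) = 1. -/
lemma sum_innov (ρ : ℝ) (j : ℕ) :
    ∑ s ∈ Finset.range (j + 1), ρ ^ (j - s) * (if s = 0 then 1 else 1 - ρ ^ 2) * ρ ^ (j - s)
      = 1 := by
  induction j with
  | zero => simp
  | succ j ih =>
    rw [Finset.sum_range_succ]
    have : ∀ s ∈ Finset.range (j + 1),
        ρ ^ (j + 1 - s) * (if s = 0 then 1 else 1 - ρ ^ 2) * ρ ^ (j + 1 - s)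
        = ρ ^ 2 * (ρ ^ (j - s) * (if s = 0 then 1 else 1 - ρ ^ 2) * ρ ^ (j - s)) := by
      intro s hs
      have : j + 1 - s = (j - s) + 1 := by have := Finset.mem_range.1 hs; omega
      rw [this, pow_succ]; ring
    rw [Finset.sum_congr rfl this, ← Finset.mul_sum, ih]
    simp

lemma arLower_mul_apply_of_le {n : ℕ} (ρ : ℝ) {i j : Fin n} (h : (j : ℕ) ≤ i) :
    (arLower n ρ * diagonal (arInnov n ρ) * (arLower n ρ)ᵀ) i j = ρ ^ ((i : ℕ) - j) := by
  rw [Matrix.mul_apply]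
  simp only [Matrix.mul_diagonal, Matrix.transpose_apply, arLower, arInnov, Matrix.of_apply]
  rw [Fin.sum_univ_eq_sum_range (fun s => (if s ≤ (i : ℕ) then ρ ^ ((i : ℕ) - s) else 0) *
    (if s = 0 then 1 else 1 - ρ ^ 2) * (if s ≤ (j : ℕ) then ρ ^ ((j : ℕ) - s) else 0)) n]
  rw [← Finset.sum_subset (s₁ := Finset.range (j + 1))]
  · have : ∀ s ∈ Finset.range ((j : ℕ) + 1), (if s ≤ (i : ℕ) then ρ ^ ((i : ℕ) - s) else 0) *
        (if s = 0 then 1 else 1 - ρ ^ 2) * (if s ≤ (j : ℕ) then ρ ^ ((j : ℕ) - s) else 0)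
        = ρ ^ ((i : ℕ) - j) *
          (ρ ^ ((j : ℕ) - s) * (if s = 0 then 1 else 1 - ρ ^ 2) * ρ ^ ((j : ℕ) - s)) := by
      intro s hs
      have hs' := Finset.mem_range.1 hs
      rw [if_pos (by omega : s ≤ (i : ℕ)), if_pos (by omega : s ≤ (j : ℕ))]
      have : (i : ℕ) - s = ((i : ℕ) - j) + (j - s) := by omega
      rw [this, pow_add]; ring
    rw [Finset.sum_congr rfl this, ← Finset.mul_sum, sum_innov, mul_one]
  · intro s hs
    have := Finset.mem_range.1 hs
    exact Finset.mem_range.2 (by omega)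
  · intro s _ hs
    have : ¬ s ≤ (j : ℕ) := fun h => hs (Finset.mem_range.2 (by omega))
    simp [this]

/-- The moving average representation of the AR(1) path, read as an LDL' factorisation. As an
algebraic identity it needs no bound on ρ; this matters because ρ̂ may exceed one in modulus when
the denominator omits a residual. -/
lemma arMatrix_eq_mul (n : ℕ) (ρ : ℝ) :
    arMatrix n ρ = arLower n ρ * diagonal (arInnov n ρ) * (arLower n ρ)ᵀ := by
  ext i j
  rcases le_total (j : ℕ) i with h | h
  · rw [arLower_mul_apply_of_le ρ h, arMatrix, Matrix.of_apply]
    congr 1; omega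
  · have hs : (arLower n ρ * diagonal (arInnov n ρ) * (arLower n ρ)ᵀ)ᵀ
        = arLower n ρ * diagonal (arInnov n ρ) * (arLower n ρ)ᵀ := by
      simp [Matrix.transpose_mul, Matrix.mul_assoc]
    rw [← hs, Matrix.transpose_apply, arLower_mul_apply_of_le ρ h, arMatrix, Matrix.of_apply]
    congr 1; omega

lemma det_arLower (n : ℕ) (ρ : ℝ) : (arLower n ρ).det = 1 := by
  rw [Matrix.det_of_isLowerTriangular]
  · simp [arLower]
  · intro i j hij
    have : ¬ (j : ℕ) ≤ i := by
      have h : i < j := hij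
      rw [Fin.lt_def] at h; omega
    simp only [arLower, Matrix.of_apply, if_neg this]

lemma det_arMatrix_ne_zero {n : ℕ} {ρ : ℝ} (h : ρ ^ 2 ≠ 1) : (arMatrix n ρ).det ≠ 0 := by
  rw [arMatrix_eq_mul, det_mul, det_mul, det_transpose, det_arLower, det_diagonal]
  simp only [one_mul, mul_one]
  refine Finset.prod_ne_zero_iff.2 fun i _ => ?_
  unfold arInnov
  split_ifs
  · exact one_ne_zero
  · exact sub_ne_zero.2 (Ne.symm h)

lemma posDef_arMatrix {n : ℕ} {ρ : ℝ} (h : |ρ| < 1) : (arMatrix n ρ).PosDef := by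
  have h2 : ρ ^ 2 < 1 := by rw [← sq_abs]; nlinarith [abs_nonneg ρ]
  rw [arMatrix_eq_mul]
  have hd : (diagonal (arInnov n ρ)).PosDef := by
    refine Matrix.PosDef.diagonal fun i => ?_
    unfold arInnov
    split_ifs <;> linarith
  have := hd.mul_mul_conjTranspose_same (B := arLower n ρ)
    (Matrix.vecMul_injective_iff_isUnit.2
      ((Matrix.isUnit_iff_isUnit_det _).2 (by rw [det_arLower]; exact isUnit_one)))
  rwa [Matrix.conjTranspose_eq_transpose_of_trivial] at this

lemma arMatrix_zero (n : ℕ) : arMatrix n 0 = 1 := by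
  ext i j
  rw [arMatrix, Matrix.of_apply, Matrix.one_apply]
  split_ifs with h
  · simp [h]
  · exact zero_pow (by intro h'; apply h; ext; omega)

lemma continuous_arMatrix (n : ℕ) : Continuous (arMatrix n) := by
  refine continuous_matrix fun i j => ?_
  simp only [arMatrix, Matrix.of_apply]
  fun_prop

/-! ### A square root of the AR(1) covariance matrix near the unit root -/

/-- `ρ(t) = (1 - t²) / (1 + t²)`, which tends to `1` as `t → 0`. -/
def arParam (t : ℝ) : ℝ := (1 - t ^ 2) / (1 + t ^ 2)

/-- `c(t) = 2 t / (1 + t²)`, so that `c(t)² = 1 - ρ(t)²`. -/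
def arScale (t : ℝ) : ℝ := 2 * t / (1 + t ^ 2)

lemma arScale_sq (t : ℝ) : arScale t ^ 2 = 1 - arParam t ^ 2 := by
  have : 1 + t ^ 2 ≠ 0 := by positivity
  unfold arScale arParam
  field_simp
  ring

/-- The reason for the rational parametrisation of the circle: 1 - ρ is c times a factor vanishing
at t = 0, so deviations from the limit can be divided by c and stay continuous down to t = 0. -/
lemma one_sub_arParam (t : ℝ) : 1 - arParam t = t * arScale t := by
  have : 1 + t ^ 2 ≠ 0 := by positivity
  unfold arScale arParam
  field_simp
  ring

lemma arScale_pos {t : ℝ} (ht : 0 < t) : 0 < arScale t := by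
  unfold arScale; positivity

lemma abs_arParam_lt {t : ℝ} (ht : 0 < t) : |arParam t| < 1 := by
  have h := arScale_sq t
  have := pow_pos (arScale_pos ht) 2
  rw [← sq_lt_one_iff_abs_lt_one]
  linarith

lemma continuous_arParam : Continuous arParam := by
  unfold arParam
  exact Continuous.div (by fun_prop) (by fun_prop) fun t => by positivity

lemma continuous_arScale : Continuous arScale := by
  unfold arScale
  exact Continuous.div (by fun_prop) (by fun_prop) fun t => by positivity

/-- The two limiting directions: vectors of signs that are geometric in the time index. -/
def IsUnitRootDir {n : ℕ} (e : Fin n → ℝ) : Prop :=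
  (∀ i, e i * e i = 1) ∧
    ∃ s : ℝ, |s| = 1 ∧ ∀ i j : Fin n, e i * e j = s ^ ((i : ℤ) - (j : ℤ)).natAbs

lemma isUnitRootDir_ePlus (n : ℕ) : IsUnitRootDir (ePlus n) :=
  ⟨fun i => by simp [ePlus], 1, by simp, fun i j => by simp [ePlus]⟩

lemma isUnitRootDir_eMinus (n : ℕ) : IsUnitRootDir (eMinus n) := by
  refine ⟨fun i => ?_, -1, by simp, fun i j => ?_⟩
  · simp only [eMinus, ← mul_pow]; norm_num
  · simp only [eMinus, ← pow_add]
    -- The exponents (i + 1) + (j + 1) and |i - j| have the same parity.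
    rw [neg_one_pow_eq_pow_mod_two, neg_one_pow_eq_pow_mod_two (((i : ℤ) - (j : ℤ)).natAbs)]
    congr 1; omega

/-- A square root of the AR(1) correlation matrix: it maps innovations to the stationary path. -/
def arFactor {n : ℕ} (e : Fin n → ℝ) (t : ℝ) : Matrix (Fin n) (Fin n) ℝ :=
  Matrix.of fun i j => e i * arLower n (arParam t) i j * (if (j : ℕ) = 0 then 1 else arScale t)

/-- Multiplying coordinates by the signs e turns Λ(ρ) into Λ(sρ), so the limits ρ → 1 and ρ → -1 are
treated at once by letting ρ(t) → 1. -/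
lemma exists_arFactor_mul_transpose {n : ℕ} {e : Fin n → ℝ} (he : IsUnitRootDir e) {t : ℝ}
    (ht : 0 < t) : arFactor e t * (arFactor e t)ᵀ ∈ arModel n := by
  obtain ⟨-, s, hs, hes⟩ := he
  have h1 : |s * arParam t| < 1 := by rw [abs_mul, hs, one_mul]; exact abs_arParam_lt ht
  refine ⟨s * arParam t, (abs_lt.1 h1).1, (abs_lt.1 h1).2, ?_⟩
  ext i j
  have h2 : arMatrix n (s * arParam t) i j = e i * e j * arMatrix n (arParam t) i j := by
    rw [hes, arMatrix, arMatrix, Matrix.of_apply, Matrix.of_apply, mul_pow]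
  rw [h2, arMatrix_eq_mul, Matrix.mul_apply, Matrix.mul_apply, Finset.mul_sum]
  refine Finset.sum_congr rfl fun k _ => ?_
  simp only [Matrix.mul_diagonal, Matrix.transpose_apply, arFactor, arInnov, Matrix.of_apply]
  split_ifs
  · ring
  · rw [← arScale_sq]; ring

/-! ### Gaussian laws as images of the standard Gaussian law -/

/-- The standard Gaussian law on `ℝⁿ`. -/
def stdNormal (n : ℕ) : Measure (Fin n → ℝ) := Measure.pi fun _ => gaussianReal 0 1

instance (n : ℕ) : IsProbabilityMeasure (stdNormal n) := by
  unfold stdNormal; infer_instance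

instance (n : ℕ) : (stdNormal n).IsOpenPosMeasure := by
  have : (gaussianReal 0 1).IsOpenPosMeasure :=
    (gaussianReal_absolutelyContinuous' 0 one_ne_zero).isOpenPosMeasure
  unfold stdNormal; infer_instance

/-- An arbitrary factor F is allowed: since ⟨Fz, x⟩ = ⟨z, F'x⟩, the characteristic function of the
image involves F only through |F'x|² = x'FF'x. -/
lemma map_stdNormal_eq_multivariateGaussian {n : ℕ} (μ : Fin n → ℝ)
    (F : Matrix (Fin n) (Fin n) ℝ) :
    (stdGaussian (EuclideanSpace ℝ (Fin n))).map
      (fun x => WithLp.toLp 2 μ + toEuclideanCLM (𝕜 := ℝ) F x) =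
    multivariateGaussian (WithLp.toLp 2 μ) (F * Fᵀ) := by
  have hS : (F * Fᵀ).PosSemidef := by
    have := Matrix.posSemidef_self_mul_conjTranspose F
    rwa [Matrix.conjTranspose_eq_transpose_of_trivial] at this
  apply Measure.ext_of_charFun
  ext x
  rw [charFun_multivariateGaussian hS]
  have hc : (fun x => WithLp.toLp 2 μ + toEuclideanCLM (𝕜 := ℝ) F x) =
      (fun x => WithLp.toLp 2 μ + x) ∘ (toEuclideanCLM (𝕜 := ℝ) F) := rfl
  rw [hc, ← Measure.map_map (measurable_const_add _) (by fun_prop), charFun_map_const_add]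
  have hn : ∀ z : EuclideanSpace ℝ (Fin n), inner ℝ (toEuclideanCLM (𝕜 := ℝ) F z) x =
      inner ℝ z (toEuclideanCLM (𝕜 := ℝ) Fᵀ x) := by
    intro z
    rw [← Matrix.conjTranspose_eq_transpose_of_trivial, ← Matrix.star_eq_conjTranspose, map_star,
      ContinuousLinearMap.star_eq_adjoint, ContinuousLinearMap.adjoint_inner_right]
  have h1 : charFun ((stdGaussian (EuclideanSpace ℝ (Fin n))).map (toEuclideanCLM (𝕜 := ℝ) F)) x =
      charFun (stdGaussian (EuclideanSpace ℝ (Fin n))) (toEuclideanCLM (𝕜 := ℝ) Fᵀ x) := by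
    rw [charFun_apply, charFun_apply, integral_map (by fun_prop) (by fun_prop)]
    simp_rw [hn]
  rw [h1, charFun_stdGaussian, ← Complex.exp_add]
  have h2 : ‖toEuclideanCLM (𝕜 := ℝ) Fᵀ x‖ ^ 2 = x.ofLp ⬝ᵥ (F * Fᵀ) *ᵥ x.ofLp := by
    rw [← real_inner_self_eq_norm_sq, EuclideanSpace.inner_eq_star_dotProduct,
      Matrix.ofLp_toEuclideanCLM]
    simp only [star_trivial]
    conv_rhs => rw [← Matrix.mulVec_mulVec, Matrix.dotProduct_mulVec, ← Matrix.mulVec_transpose]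
  rw [← Complex.ofReal_pow, h2, real_inner_comm]
  congr 1
  ring

lemma gaussianLaw_smul_mul_transpose {n : ℕ} (μ : Fin n → ℝ) (F : Matrix (Fin n) (Fin n) ℝ)
    (σ : ℝ) : gaussianLaw μ (σ ^ 2 • (F * Fᵀ)) =
      (stdNormal n).map (fun ξ => μ + σ • (F *ᵥ ξ)) := by
  have h : σ ^ 2 • (F * Fᵀ) = (σ • F) * (σ • F)ᵀ := by
    rw [Matrix.transpose_smul, Matrix.smul_mul, Matrix.mul_smul, smul_smul, sq]
  rw [gaussianLaw, h, ← map_stdNormal_eq_multivariateGaussian, ← map_pi_eq_stdGaussian,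
    Measure.map_map (by fun_prop) (by fun_prop), Measure.map_map (by fun_prop) (by fun_prop)]
  rw [stdNormal]
  congr 1
  ext ξ : 1
  simp

lemma gaussianLaw_apply {n : ℕ} (μ : Fin n → ℝ) (F : Matrix (Fin n) (Fin n) ℝ)
    (σ : ℝ) {W : Set (Fin n → ℝ)} (hW : MeasurableSet W) :
    gaussianLaw μ (σ ^ 2 • (F * Fᵀ)) W = stdNormal n {ξ | μ + σ • (F *ᵥ ξ) ∈ W} := by
  rw [gaussianLaw_smul_mul_transpose, Measure.map_apply _ hW]
  · rfl
  · have : Continuous fun ξ : Fin n → ℝ => μ + σ • (F *ᵥ ξ) := by fun_prop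
    exact this.measurable

instance {n : ℕ} (μ : Fin n → ℝ) (Φ : Matrix (Fin n) (Fin n) ℝ) :
    IsProbabilityMeasure (gaussianLaw μ Φ) := by
  unfold gaussianLaw
  exact Measure.isProbabilityMeasure_map (by fun_prop)

/-! ### Rank conditions -/

lemma mulVec_injective_of_rank {m k : ℕ} {X : Matrix (Fin m) (Fin k) ℝ} (hX : X.rank = k) :
    Function.Injective X.mulVec := by
  have h := LinearMap.finrank_range_add_finrank_ker X.mulVecLin
  have h2 : Module.finrank ℝ (LinearMap.range X.mulVecLin) = k := hX
  rw [h2, Module.finrank_fin_fun] at h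
  have h3 : LinearMap.ker X.mulVecLin = ⊥ := Submodule.finrank_eq_zero.1 (by omega)
  exact LinearMap.ker_eq_bot.1 h3

lemma mulVec_surjective_of_rank {q k : ℕ} {R : Matrix (Fin q) (Fin k) ℝ} (hR : R.rank = q) :
    Function.Surjective R.mulVec := by
  have h2 : LinearMap.range R.mulVecLin = ⊤ := by
    apply Submodule.eq_top_of_finrank_eq
    rw [Module.finrank_fin_fun]
    exact hR
  exact LinearMap.range_eq_top.1 h2

section Estimators

variable {n k q : ℕ} {X : Matrix (Fin n) (Fin k) ℝ} {R : Matrix (Fin q) (Fin k) ℝ}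
  {a₁ a₂ : ℕ}

lemma posDef_gram (hX : X.rank = k) : (Xᵀ * X).PosDef := by
  have := (Matrix.PosDef.one (n := Fin n) (R := ℝ)).conjTranspose_mul_mul_same
    (mulVec_injective_of_rank hX)
  rwa [Matrix.conjTranspose_eq_transpose_of_trivial, Matrix.mul_one] at this

lemma isUnit_det_gram (hX : X.rank = k) : IsUnit (Xᵀ * X).det :=
  (posDef_gram hX).det_pos.ne'.isUnit

/-! ### Equivariance -/

lemma betaHat_smul_add (hX : X.rank = k) (s : ℝ) (y : Fin n → ℝ) (β : Fin k → ℝ) :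
    betaHat X (s • y + X *ᵥ β) = s • betaHat X y + β := by
  unfold betaHat
  rw [Matrix.mulVec_add, Matrix.mulVec_add, Matrix.mulVec_smul, Matrix.mulVec_smul,
    Matrix.mulVec_mulVec β, Matrix.mulVec_mulVec β, Matrix.nonsing_inv_mul _ (isUnit_det_gram hX),
    Matrix.one_mulVec]

lemma resid_smul_add (hX : X.rank = k) (s : ℝ) (y : Fin n → ℝ) (β : Fin k → ℝ) :
    resid X (s • y + X *ᵥ β) = s • resid X y := by
  unfold resid
  rw [betaHat_smul_add hX, Matrix.mulVec_add, Matrix.mulVec_smul, smul_sub]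
  abel

lemma resid_mulVec (hX : X.rank = k) (β : Fin k → ℝ) : resid X (X *ᵥ β) = 0 := by
  have := resid_smul_add hX 0 0 β
  simpa using this

lemma lagSum_smul_add (hX : X.rank = k) (s : ℝ) (y : Fin n → ℝ) (β : Fin k → ℝ) :
    lagSum X (s • y + X *ᵥ β) = s ^ 2 * lagSum X y := by
  simp only [lagSum, resid_smul_add hX, Finset.mul_sum, Pi.smul_apply, smul_eq_mul]
  refine Finset.sum_congr rfl fun i _ => Finset.sum_congr rfl fun j _ => ?_
  split_ifs <;> ring

lemma sqSum_smul_add (hX : X.rank = k) (s : ℝ) (y : Fin n → ℝ) (β : Fin k → ℝ) :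
    sqSum X a₁ a₂ (s • y + X *ᵥ β) = s ^ 2 * sqSum X a₁ a₂ y := by
  simp only [sqSum, resid_smul_add hX, Finset.mul_sum, Pi.smul_apply, smul_eq_mul]
  refine Finset.sum_congr rfl fun i _ => ?_
  split_ifs <;> ring

lemma rhoHat_smul_add (hX : X.rank = k) {s : ℝ} (hs : s ≠ 0) (y : Fin n → ℝ) (β : Fin k → ℝ) :
    rhoHat X a₁ a₂ (s • y + X *ᵥ β) = rhoHat X a₁ a₂ y := by
  rw [rhoHat, lagSum_smul_add hX, sqSum_smul_add hX, mul_div_mul_left _ _ (pow_ne_zero 2 hs)]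
  rfl

lemma lambdaHat_smul_add (hX : X.rank = k) {s : ℝ} (hs : s ≠ 0) (y : Fin n → ℝ)
    (β : Fin k → ℝ) : lambdaHat X a₁ a₂ (s • y + X *ᵥ β) = lambdaHat X a₁ a₂ y := by
  rw [lambdaHat, rhoHat_smul_add hX hs]; rfl

lemma glsGram_smul_add (hX : X.rank = k) {s : ℝ} (hs : s ≠ 0) (y : Fin n → ℝ)
    (β : Fin k → ℝ) : glsGram X a₁ a₂ (s • y + X *ᵥ β) = glsGram X a₁ a₂ y := by
  rw [glsGram, lambdaHat_smul_add hX hs]; rfl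

lemma mem_N1_smul_add (hX : X.rank = k) {s : ℝ} (hs : s ≠ 0) (y : Fin n → ℝ)
    (β : Fin k → ℝ) : s • y + X *ᵥ β ∈ N1 X a₁ a₂ ↔ y ∈ N1 X a₁ a₂ := by
  have : 0 < s ^ 2 := by positivity
  simp only [N1, Set.mem_ofPred_eq, lagSum_smul_add hX, sqSum_smul_add hX, abs_mul,
    abs_of_pos this]
  exact mul_right_inj' this.ne'

lemma betaTilde_smul_add (hX : X.rank = k) {s : ℝ} (hs : s ≠ 0) {y : Fin n → ℝ}
    (hy : (glsGram X a₁ a₂ y).det ≠ 0) (β : Fin k → ℝ) :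
    betaTilde X a₁ a₂ (s • y + X *ᵥ β) = s • betaTilde X a₁ a₂ y + β := by
  unfold betaTilde
  rw [glsGram_smul_add hX hs, lambdaHat_smul_add hX hs]
  simp only [Matrix.mulVec_add, Matrix.mulVec_smul]
  congr 1
  rw [Matrix.mulVec_mulVec, Matrix.mulVec_mulVec, Matrix.mulVec_mulVec]
  have : (glsGram X a₁ a₂ y)⁻¹ * Xᵀ * (lambdaHat X a₁ a₂ y)⁻¹ * X =
      (glsGram X a₁ a₂ y)⁻¹ * glsGram X a₁ a₂ y := by
    simp only [glsGram, Matrix.mul_assoc]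
  rw [this, Matrix.nonsing_inv_mul _ hy.isUnit, Matrix.one_mulVec]

lemma sigmaTildeSq_smul_add (hX : X.rank = k) {s : ℝ} (hs : s ≠ 0) {y : Fin n → ℝ}
    (hy : (glsGram X a₁ a₂ y).det ≠ 0) (β : Fin k → ℝ) :
    sigmaTildeSq X a₁ a₂ (s • y + X *ᵥ β) = s ^ 2 * sigmaTildeSq X a₁ a₂ y := by
  have : s • y + X *ᵥ β - X *ᵥ (s • betaTilde X a₁ a₂ y + β) =
      s • (y - X *ᵥ betaTilde X a₁ a₂ y) := by
    rw [Matrix.mulVec_add, Matrix.mulVec_smul, smul_sub]; abel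
  unfold sigmaTildeSq
  rw [betaTilde_smul_add hX hs hy, this, lambdaHat_smul_add hX hs, Matrix.mulVec_smul,
    smul_dotProduct, dotProduct_smul, smul_eq_mul, smul_eq_mul]
  ring

lemma sigmaHatSq_smul_add (hX : X.rank = k) (s : ℝ) (y : Fin n → ℝ) (β : Fin k → ℝ) :
    sigmaHatSq X (s • y + X *ᵥ β) = s ^ 2 * sigmaHatSq X y := by
  unfold sigmaHatSq
  rw [resid_smul_add hX, smul_dotProduct, dotProduct_smul, smul_eq_mul, smul_eq_mul]
  ring

lemma glsShape_smul_add (hX : X.rank = k) {s : ℝ} (hs : s ≠ 0) (y : Fin n → ℝ)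
    (β : Fin k → ℝ) : glsShape X R a₁ a₂ (s • y + X *ᵥ β) = glsShape X R a₁ a₂ y := by
  rw [glsShape, glsGram_smul_add hX hs]; rfl

lemma olsShape_smul_add (hX : X.rank = k) {s : ℝ} (hs : s ≠ 0) (y : Fin n → ℝ)
    (β : Fin k → ℝ) : olsShape X R a₁ a₂ (s • y + X *ᵥ β) = olsShape X R a₁ a₂ y := by
  rw [olsShape, lambdaHat_smul_add hX hs]; rfl

/-- The estimator of the regression coefficients used by the test of the given kind. -/
def coefEst (κ : TestKind) (X : Matrix (Fin n) (Fin k) ℝ) (a₁ a₂ : ℕ) (y : Fin n → ℝ) :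
    Fin k → ℝ :=
  match κ with
  | .fgls => betaTilde X a₁ a₂ y
  | .ols => betaHat X y

/-- The inverse covariance estimator used by the test of the given kind. -/
def weight (κ : TestKind) (X : Matrix (Fin n) (Fin k) ℝ) (R : Matrix (Fin q) (Fin k) ℝ)
    (a₁ a₂ : ℕ) (y : Fin n → ℝ) : Matrix (Fin q) (Fin q) ℝ :=
  match κ with
  | .fgls => (omegaTilde X R a₁ a₂ y)⁻¹
  | .ols => (omegaHat X R a₁ a₂ y)⁻¹

lemma stat_of_mem {κ : TestKind} {y : Fin n → ℝ} (r : Fin q → ℝ)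
    (hy : y ∈ excSet κ X R a₁ a₂) : stat κ X R r a₁ a₂ y = 0 := by
  cases κ
  · exact if_pos hy
  · exact if_pos hy

lemma stat_of_notMem {κ : TestKind} {y : Fin n → ℝ} (r : Fin q → ℝ)
    (hy : y ∉ excSet κ X R a₁ a₂) :
    stat κ X R r a₁ a₂ y = (R *ᵥ coefEst κ X a₁ a₂ y - r) ⬝ᵥ
      (weight κ X R a₁ a₂ y *ᵥ (R *ᵥ coefEst κ X a₁ a₂ y - r)) := by
  cases κ
  · exact if_neg hy
  · exact if_neg hy

lemma notMem_N2 {y : Fin n → ℝ} :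
    y ∉ N2 X a₁ a₂ ↔ y ∉ N1 X a₁ a₂ ∧ (glsGram X a₁ a₂ y).det ≠ 0 := by
  simp only [N2, Set.mem_compl_iff, not_not, Set.mem_ofPred_eq]

lemma notMem_excSet_fgls {y : Fin n → ℝ} :
    y ∉ excSet .fgls X R a₁ a₂ ↔ (y ∉ N1 X a₁ a₂ ∧ (glsGram X a₁ a₂ y).det ≠ 0) ∧
      sigmaTildeSq X a₁ a₂ y ≠ 0 ∧ (glsShape X R a₁ a₂ y).det ≠ 0 := by
  simp only [excSet, N2star, Set.mem_compl_iff, not_not, Set.mem_ofPred_eq, notMem_N2]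

lemma notMem_excSet_ols {y : Fin n → ℝ} :
    y ∉ excSet .ols X R a₁ a₂ ↔ sqSum X a₁ a₂ y ≠ 0 ∧ (olsShape X R a₁ a₂ y).det ≠ 0 := by
  simp only [excSet, N0star, Set.mem_compl_iff, not_not, Set.mem_ofPred_eq, N0]

lemma notMem_excSet_smul_add (hX : X.rank = k) (κ : TestKind) {s : ℝ} (hs : s ≠ 0)
    {y : Fin n → ℝ} (β : Fin k → ℝ) (hy : y ∉ excSet κ X R a₁ a₂) :
    s • y + X *ᵥ β ∉ excSet κ X R a₁ a₂ := by
  cases κ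
  · rw [notMem_excSet_fgls] at hy ⊢
    rw [mem_N1_smul_add hX hs, glsGram_smul_add hX hs, sigmaTildeSq_smul_add hX hs hy.1.2,
      glsShape_smul_add hX hs]
    exact ⟨hy.1, mul_ne_zero (pow_ne_zero 2 hs) hy.2.1, hy.2.2⟩
  · rw [notMem_excSet_ols] at hy ⊢
    rw [sqSum_smul_add hX, olsShape_smul_add hX hs]
    exact ⟨mul_ne_zero (pow_ne_zero 2 hs) hy.1, hy.2⟩

lemma coefEst_smul_add (hX : X.rank = k) (κ : TestKind) {s : ℝ} (hs : s ≠ 0)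
    {y : Fin n → ℝ} (β : Fin k → ℝ) (hy : y ∉ excSet κ X R a₁ a₂) :
    coefEst κ X a₁ a₂ (s • y + X *ᵥ β) = s • coefEst κ X a₁ a₂ y + β := by
  cases κ
  · exact betaTilde_smul_add hX hs (notMem_excSet_fgls.1 hy).1.2 β
  · exact betaHat_smul_add hX s y β

lemma inv_smul_mul {m : ℕ} {a b : ℝ} (ha : a ≠ 0) (M : Matrix (Fin m) (Fin m) ℝ) :
    ((a * b) • M)⁻¹ = a⁻¹ • (b • M)⁻¹ := by
  rw [mul_smul, show a • (b • M) = Units.mk0 a ha • (b • M) from rfl]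
  by_cases h : IsUnit (b • M).det
  · rw [Matrix.inv_smul' _ _ h]; rfl
  -- If `b • M` is singular, both inverses take the default value 0.
  · rw [Matrix.nonsing_inv_apply_not_isUnit _ h, Matrix.nonsing_inv_apply_not_isUnit, smul_zero]
    intro h'
    rw [show Units.mk0 a ha • (b • M) = a • (b • M) from rfl, Matrix.det_smul] at h'
    exact h (isUnit_of_mul_isUnit_right h')

lemma weight_smul_add (hX : X.rank = k) (κ : TestKind) {s : ℝ} (hs : s ≠ 0)
    {y : Fin n → ℝ} (β : Fin k → ℝ) (hy : y ∉ excSet κ X R a₁ a₂) :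
    weight κ X R a₁ a₂ (s • y + X *ᵥ β) = (s ^ 2)⁻¹ • weight κ X R a₁ a₂ y := by
  cases κ
  · simp only [weight, omegaTilde]
    rw [sigmaTildeSq_smul_add hX hs (notMem_excSet_fgls.1 hy).1.2, glsShape_smul_add hX hs,
      inv_smul_mul (pow_ne_zero 2 hs)]
  · simp only [weight, omegaHat]
    rw [sigmaHatSq_smul_add hX, olsShape_smul_add hX hs, inv_smul_mul (pow_ne_zero 2 hs)]

/-- The value of the test statistic after an affine change of the sample. -/
lemma stat_smul_add (hX : X.rank = k) (κ : TestKind) (r : Fin q → ℝ) {s : ℝ} (hs : s ≠ 0)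
    {y : Fin n → ℝ} (β : Fin k → ℝ) (hy : y ∉ excSet κ X R a₁ a₂) :
    stat κ X R r a₁ a₂ (s • y + X *ᵥ β) =
      (R *ᵥ coefEst κ X a₁ a₂ y + s⁻¹ • (R *ᵥ β - r)) ⬝ᵥ
        (weight κ X R a₁ a₂ y *ᵥ (R *ᵥ coefEst κ X a₁ a₂ y + s⁻¹ • (R *ᵥ β - r))) := by
  have h : R *ᵥ (s • coefEst κ X a₁ a₂ y + β) - r =
      s • (R *ᵥ coefEst κ X a₁ a₂ y + s⁻¹ • (R *ᵥ β - r)) := by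
    rw [smul_add, smul_smul, mul_inv_cancel₀ hs, one_smul, Matrix.mulVec_add, Matrix.mulVec_smul,
      add_sub_assoc]
  rw [stat_of_notMem r (notMem_excSet_smul_add hX κ hs β hy), coefEst_smul_add hX κ hs β hy,
    weight_smul_add hX κ hs β hy, h, Matrix.smul_mulVec, Matrix.mulVec_smul, smul_dotProduct,
    dotProduct_smul, dotProduct_smul, smul_eq_mul, smul_eq_mul, smul_eq_mul]
  field_simp

lemma mem_excSet_smul_add (hX : X.rank = k) (κ : TestKind) {s : ℝ} (hs : s ≠ 0)
    (y : Fin n → ℝ) (β : Fin k → ℝ) :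
    s • y + X *ᵥ β ∈ excSet κ X R a₁ a₂ ↔ y ∈ excSet κ X R a₁ a₂ := by
  constructor
  · intro h
    by_contra hy
    exact notMem_excSet_smul_add hX κ hs β hy h
  · intro h
    by_contra hy
    -- The inverse of the affine map has the same form, with scale s⁻¹ and shift -s⁻¹β.
    have := notMem_excSet_smul_add hX κ (inv_ne_zero hs) (-(s⁻¹ • β)) hy
    rw [smul_add, smul_smul, inv_mul_cancel₀ hs, one_smul, Matrix.mulVec_neg, Matrix.mulVec_smul,
      add_neg_cancel_right] at this
    exact this h

/-! ### Continuity -/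

lemma continuous_betaHat : Continuous (betaHat X) := by
  unfold betaHat; fun_prop

lemma continuous_resid : Continuous (resid X) := by
  have := continuous_betaHat (X := X)
  unfold resid; fun_prop

lemma continuous_lagSum : Continuous (lagSum X) := by
  have h := continuous_resid (X := X)
  unfold lagSum
  refine continuous_finsetSum _ fun i _ => continuous_finsetSum _ fun j _ => ?_
  split_ifs <;> fun_prop

lemma continuous_sqSum : Continuous (sqSum X a₁ a₂) := by
  have h := continuous_resid (X := X)
  unfold sqSum
  refine continuous_finsetSum _ fun i _ => ?_
  split_ifs <;> fun_prop

lemma continuousAt_matrix_inv {α : Type*} [TopologicalSpace α] {m : ℕ}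
    {A : α → Matrix (Fin m) (Fin m) ℝ} {a : α} (hA : ContinuousAt A a) (h : (A a).det ≠ 0) :
    ContinuousAt (fun x => (A x)⁻¹) a := by
  simp only [Matrix.inv_def, Ring.inverse_eq_inv']
  have h1 : ContinuousAt (fun x => (A x).det) a :=
    (Continuous.matrix_det continuous_id).continuousAt.comp hA
  have h2 : ContinuousAt (fun x => (A x).adjugate) a :=
    (Continuous.matrix_adjugate continuous_id).continuousAt.comp hA
  exact (h1.inv₀ h).smul h2

lemma continuousAt_lambdaHat {y : Fin n → ℝ} (hy : sqSum X a₁ a₂ y ≠ 0) :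
    ContinuousAt (lambdaHat X a₁ a₂) y :=
  (continuous_arMatrix n).continuousAt.comp
    (continuous_lagSum.continuousAt.div continuous_sqSum.continuousAt hy)

/-- Admissible summation ranges in the denominator of the estimator of the autoregressive
parameter. -/
def IsAdmissible (n k a₁ a₂ : ℕ) : Prop :=
  (a₁ = 1 ∨ a₁ = 2) ∧ (a₂ = n - 1 ∨ a₂ = n) ∧ k + a₁ ≤ a₂ ∧ 1 ≤ k ∧ k < n

lemma resid_eq_zero_of_sqSum {y : Fin n → ℝ} (hy : sqSum X a₁ a₂ y = 0) {i : Fin n}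
    (h1 : a₁ ≤ (i : ℕ) + 1) (h2 : (i : ℕ) + 1 ≤ a₂) : resid X y i = 0 := by
  have h := (Finset.sum_eq_zero_iff_of_nonneg (fun i _ => by split_ifs <;> positivity)).1 hy i
    (Finset.mem_univ i)
  rw [if_pos ⟨h1, h2⟩] at h
  exact pow_eq_zero_iff two_ne_zero |>.1 h

/-- Every product û_t û_{t-1} has a factor whose index lies in [a₁, a₂]: û_t itself if t ≤ a₂,
otherwise t = n, a₂ = n - 1 and û_{n-1} serves. Hence a zero denominator forces a zero numerator. -/
lemma N0_subset_N1 (ha : IsAdmissible n k a₁ a₂) : N0 X a₁ a₂ ⊆ N1 X a₁ a₂ := by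
  intro y hy
  have hy' : sqSum X a₁ a₂ y = 0 := hy
  have : lagSum X y = 0 := by
    refine Finset.sum_eq_zero fun i _ => Finset.sum_eq_zero fun j _ => ?_
    split_ifs with hij
    · obtain ⟨h1, h2, h3, h4, h5⟩ := ha
      have hi := i.2
      by_cases hc : (i : ℕ) + 1 ≤ a₂
      · rw [resid_eq_zero_of_sqSum hy' (by omega) hc, zero_mul]
      · rw [resid_eq_zero_of_sqSum hy' (i := j) (by omega) (by omega), mul_zero]
    · rfl
  simp [N1, this, hy']

lemma sqSum_ne_zero_of_notMem_N1 (ha : IsAdmissible n k a₁ a₂) {y : Fin n → ℝ}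
    (hy : y ∉ N1 X a₁ a₂) : sqSum X a₁ a₂ y ≠ 0 :=
  fun h => hy (N0_subset_N1 ha h)

lemma sqSum_nonneg (y : Fin n → ℝ) : 0 ≤ sqSum X a₁ a₂ y :=
  Finset.sum_nonneg fun i _ => by split_ifs <;> positivity

lemma det_lambdaHat_ne_zero (ha : IsAdmissible n k a₁ a₂) {y : Fin n → ℝ}
    (hy : y ∉ N1 X a₁ a₂) : (lambdaHat X a₁ a₂ y).det ≠ 0 := by
  refine det_arMatrix_ne_zero fun h => hy ?_
  have h0 := sqSum_ne_zero_of_notMem_N1 ha hy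
  rw [rhoHat, div_pow, div_eq_one_iff_eq (pow_ne_zero 2 h0)] at h
  have := (sq_eq_sq_iff_abs_eq_abs _ _).1 h
  rwa [abs_of_nonneg (sqSum_nonneg y)] at this

lemma isClosed_N1 : IsClosed (N1 X a₁ a₂) :=
  isClosed_eq continuous_lagSum.abs continuous_sqSum

lemma resid_ne_zero_of_sqSum {y : Fin n → ℝ} (hy : sqSum X a₁ a₂ y ≠ 0) : resid X y ≠ 0 := by
  intro h
  apply hy
  simp [sqSum, h]

lemma sigmaHatSq_pos (hkn : k < n) {y : Fin n → ℝ} (hy : resid X y ≠ 0) :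
    0 < sigmaHatSq X y := by
  have : (k : ℝ) < n := by exact_mod_cast hkn
  refine mul_pos (inv_pos.2 (by linarith)) ?_
  have h1 : 0 ≤ resid X y ⬝ᵥ resid X y := Finset.sum_nonneg fun i _ => mul_self_nonneg _
  exact lt_of_le_of_ne h1 fun h => hy (dotProduct_self_eq_zero.1 h.symm)

lemma continuousAt_lambdaHat_inv (ha : IsAdmissible n k a₁ a₂) {y : Fin n → ℝ}
    (hy : y ∉ N1 X a₁ a₂) : ContinuousAt (fun z => (lambdaHat X a₁ a₂ z)⁻¹) y :=
  continuousAt_matrix_inv (continuousAt_lambdaHat (sqSum_ne_zero_of_notMem_N1 ha hy))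
    (det_lambdaHat_ne_zero ha hy)

lemma continuousAt_mul {α : Type*} [TopologicalSpace α] {l m p : ℕ}
    {A : α → Matrix (Fin l) (Fin m) ℝ} {B : α → Matrix (Fin m) (Fin p) ℝ} {a : α}
    (hA : ContinuousAt A a) (hB : ContinuousAt B a) : ContinuousAt (fun x => A x * B x) a :=
  (Continuous.matrix_mul continuous_fst continuous_snd).continuousAt.comp₂_of_eq hA hB rfl

lemma continuousAt_mulVec {α : Type*} [TopologicalSpace α] {l m : ℕ}
    {A : α → Matrix (Fin l) (Fin m) ℝ} {v : α → Fin m → ℝ} {a : α}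
    (hA : ContinuousAt A a) (hv : ContinuousAt v a) : ContinuousAt (fun x => A x *ᵥ v x) a :=
  (Continuous.matrix_mulVec continuous_fst continuous_snd).continuousAt.comp₂_of_eq hA hv rfl

lemma continuousAt_dotProduct {α : Type*} [TopologicalSpace α] {m : ℕ}
    {u v : α → Fin m → ℝ} {a : α}
    (hu : ContinuousAt u a) (hv : ContinuousAt v a) : ContinuousAt (fun x => u x ⬝ᵥ v x) a :=
  (Continuous.dotProduct continuous_fst continuous_snd).continuousAt.comp₂_of_eq hu hv rfl

lemma continuousAt_det {α : Type*} [TopologicalSpace α] {m : ℕ}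
    {A : α → Matrix (Fin m) (Fin m) ℝ} {a : α}
    (hA : ContinuousAt A a) : ContinuousAt (fun x => (A x).det) a :=
  (Continuous.matrix_det continuous_id).continuousAt.comp hA

lemma continuousAt_glsGram (ha : IsAdmissible n k a₁ a₂) {y : Fin n → ℝ}
    (hy : y ∉ N1 X a₁ a₂) : ContinuousAt (glsGram X a₁ a₂) y :=
  continuousAt_mul (continuousAt_mul continuousAt_const (continuousAt_lambdaHat_inv ha hy))
    continuousAt_const

lemma continuousAt_betaTilde (ha : IsAdmissible n k a₁ a₂) {y : Fin n → ℝ}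
    (hy : y ∉ N1 X a₁ a₂) (h : (glsGram X a₁ a₂ y).det ≠ 0) :
    ContinuousAt (betaTilde X a₁ a₂) y :=
  continuousAt_mulVec (continuousAt_matrix_inv (continuousAt_glsGram ha hy) h)
    (continuousAt_mulVec continuousAt_const
      (continuousAt_mulVec (continuousAt_lambdaHat_inv ha hy) continuousAt_id))

lemma continuousAt_sigmaTildeSq (ha : IsAdmissible n k a₁ a₂) {y : Fin n → ℝ}
    (hy : y ∉ N1 X a₁ a₂) (h : (glsGram X a₁ a₂ y).det ≠ 0) :
    ContinuousAt (sigmaTildeSq X a₁ a₂) y := by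
  have h1 : ContinuousAt (fun z => z - X *ᵥ betaTilde X a₁ a₂ z) y :=
    continuousAt_id.sub (continuousAt_mulVec continuousAt_const (continuousAt_betaTilde ha hy h))
  exact continuousAt_const.mul (continuousAt_dotProduct h1
    (continuousAt_mulVec (continuousAt_lambdaHat_inv ha hy) h1))

lemma continuousAt_glsShape (ha : IsAdmissible n k a₁ a₂) {y : Fin n → ℝ}
    (hy : y ∉ N1 X a₁ a₂) (h : (glsGram X a₁ a₂ y).det ≠ 0) :
    ContinuousAt (glsShape X R a₁ a₂) y :=
  continuousAt_mul (continuousAt_mul continuousAt_const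
    (continuousAt_matrix_inv (continuousAt_glsGram ha hy) h)) continuousAt_const

lemma continuousAt_olsShape {y : Fin n → ℝ} (hy : sqSum X a₁ a₂ y ≠ 0) :
    ContinuousAt (olsShape X R a₁ a₂) y :=
  continuousAt_mul (continuousAt_mul (continuousAt_mul (continuousAt_mul continuousAt_const
    (continuousAt_lambdaHat hy)) continuousAt_const) continuousAt_const) continuousAt_const

lemma continuous_sigmaHatSq : Continuous (sigmaHatSq X) := by
  have := continuous_resid (X := X)
  unfold sigmaHatSq
  fun_prop

lemma isOpen_compl_excSet (ha : IsAdmissible n k a₁ a₂) (κ : TestKind) :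
    IsOpen (excSet κ X R a₁ a₂)ᶜ := by
  rw [isOpen_iff_mem_nhds]
  intro y hy
  cases κ
  · obtain ⟨⟨h1, h2⟩, h3, h4⟩ := notMem_excSet_fgls.1 hy
    filter_upwards [isClosed_N1.isOpen_compl.mem_nhds h1,
      (continuousAt_det (continuousAt_glsGram ha h1)).eventually_ne h2,
      (continuousAt_sigmaTildeSq ha h1 h2).eventually_ne h3,
      (continuousAt_det (continuousAt_glsShape (R := R) ha h1 h2)).eventually_ne h4]
      with z g1 g2 g3 g4
    exact notMem_excSet_fgls.2 ⟨⟨g1, g2⟩, g3, g4⟩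
  · obtain ⟨h1, h2⟩ := notMem_excSet_ols.1 hy
    filter_upwards [continuous_sqSum.continuousAt.eventually_ne h1,
      (continuousAt_det (continuousAt_olsShape (R := R) h1)).eventually_ne h2] with z g1 g2
    exact notMem_excSet_ols.2 ⟨g1, g2⟩

lemma continuousAt_coefEst (ha : IsAdmissible n k a₁ a₂) (κ : TestKind) {y : Fin n → ℝ}
    (hy : y ∉ excSet κ X R a₁ a₂) : ContinuousAt (coefEst κ X a₁ a₂) y := by
  cases κ
  · obtain ⟨⟨h1, h2⟩, -⟩ := notMem_excSet_fgls.1 hy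
    exact continuousAt_betaTilde ha h1 h2
  · exact continuous_betaHat.continuousAt

lemma continuousAt_weight (ha : IsAdmissible n k a₁ a₂) (κ : TestKind) {y : Fin n → ℝ}
    (hy : y ∉ excSet κ X R a₁ a₂) : ContinuousAt (weight κ X R a₁ a₂) y := by
  cases κ
  · obtain ⟨⟨h1, h2⟩, h3, h4⟩ := notMem_excSet_fgls.1 hy
    refine continuousAt_matrix_inv ((continuousAt_sigmaTildeSq ha h1 h2).smul
      (continuousAt_glsShape ha h1 h2)) ?_
    rw [omegaTilde, Matrix.det_smul]
    exact mul_ne_zero (pow_ne_zero _ h3) h4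
  · obtain ⟨h1, h2⟩ := notMem_excSet_ols.1 hy
    refine continuousAt_matrix_inv (continuous_sigmaHatSq.continuousAt.smul
      (continuousAt_olsShape h1)) ?_
    rw [omegaHat, Matrix.det_smul]
    exact mul_ne_zero (pow_ne_zero _
      (sigmaHatSq_pos ha.2.2.2.2 (resid_ne_zero_of_sqSum h1)).ne') h2

lemma continuousAt_stat (ha : IsAdmissible n k a₁ a₂) (κ : TestKind) (r : Fin q → ℝ)
    {y : Fin n → ℝ} (hy : y ∉ excSet κ X R a₁ a₂) : ContinuousAt (stat κ X R r a₁ a₂) y := by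
  have h1 : ContinuousAt (fun z => R *ᵥ coefEst κ X a₁ a₂ z - r) y :=
    (continuousAt_mulVec continuousAt_const (continuousAt_coefEst ha κ hy)).sub continuousAt_const
  refine (continuousAt_dotProduct h1
    (continuousAt_mulVec (continuousAt_weight ha κ hy) h1)).congr ?_
  filter_upwards [(isOpen_compl_excSet ha κ).mem_nhds hy] with z hz
  exact (stat_of_notMem r hz).symm

/-- Since C > 0 and the statistic is 0 on the exceptional set, the region lies in the open
complement of that set, and by continuity it is relatively closed there. -/
lemma measurableSet_rejRegion (ha : IsAdmissible n k a₁ a₂) (κ : TestKind) (r : Fin q → ℝ)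
    {C : ℝ} (hC : 0 < C) : MeasurableSet (rejRegion κ X R r a₁ a₂ C) := by
  have hopen := isOpen_compl_excSet (X := X) (R := R) ha κ
  have h1 : IsOpen ((excSet κ X R a₁ a₂)ᶜ ∩ stat κ X R r a₁ a₂ ⁻¹' Set.Iio C) :=
    ContinuousOn.isOpen_inter_preimage
      (fun y hy => (continuousAt_stat ha κ r hy).continuousWithinAt) hopen isOpen_Iio
  have h2 : rejRegion κ X R r a₁ a₂ C = (excSet κ X R a₁ a₂)ᶜ \
      ((excSet κ X R a₁ a₂)ᶜ ∩ stat κ X R r a₁ a₂ ⁻¹' Set.Iio C) := by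
    ext y
    simp only [rejRegion, Set.mem_ofPred_eq, Set.mem_sdiff, Set.mem_inter_iff, Set.mem_preimage,
      Set.mem_Iio, not_and, not_lt]
    constructor
    · intro h
      refine ⟨fun hy => ?_, fun _ => h⟩
      rw [stat_of_mem r hy] at h
      linarith
    · exact fun h => h.2 h.1
  rw [h2]
  exact hopen.measurableSet.diff h1.measurableSet

/-! ### Samples with stationary autoregressive estimate -/

/-- The set of samples whose estimated autoregressive parameter is less than one in modulus. -/
def statSet (X : Matrix (Fin n) (Fin k) ℝ) (a₁ a₂ : ℕ) : Set (Fin n → ℝ) :=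
  {y | |lagSum X y| < sqSum X a₁ a₂ y}

lemma isOpen_statSet : IsOpen (statSet X a₁ a₂) :=
  isOpen_lt continuous_lagSum.abs continuous_sqSum

lemma sqSum_pos_of_mem_statSet {y : Fin n → ℝ} (hy : y ∈ statSet X a₁ a₂) :
    0 < sqSum X a₁ a₂ y := (abs_nonneg _).trans_lt hy

lemma posDef_lambdaHat {y : Fin n → ℝ} (hy : y ∈ statSet X a₁ a₂) :
    (lambdaHat X a₁ a₂ y).PosDef := by
  refine posDef_arMatrix ?_
  rw [rhoHat, abs_div, abs_of_pos (sqSum_pos_of_mem_statSet hy),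
    div_lt_one (sqSum_pos_of_mem_statSet hy)]
  exact hy

lemma posDef_conj {m p : ℕ} {A : Matrix (Fin m) (Fin m) ℝ} (hA : A.PosDef)
    {B : Matrix (Fin m) (Fin p) ℝ} (hB : Function.Injective B.mulVec) : (Bᵀ * A * B).PosDef := by
  have := hA.conjTranspose_mul_mul_same hB
  rwa [Matrix.conjTranspose_eq_transpose_of_trivial] at this

lemma posDef_glsGram (hX : X.rank = k) {y : Fin n → ℝ} (hy : y ∈ statSet X a₁ a₂) :
    (glsGram X a₁ a₂ y).PosDef :=
  posDef_conj (posDef_lambdaHat hy).inv (mulVec_injective_of_rank hX)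

lemma posDef_glsShape (hX : X.rank = k) (hR : R.rank = q) {y : Fin n → ℝ}
    (hy : y ∈ statSet X a₁ a₂) : (glsShape X R a₁ a₂ y).PosDef := by
  have := posDef_conj (posDef_glsGram hX hy).inv
    (mulVec_injective_of_rank (X := Rᵀ) (by rw [Matrix.rank_transpose, hR]))
  rwa [Matrix.transpose_transpose] at this

lemma posDef_olsShape (hX : X.rank = k) (hR : R.rank = q) {y : Fin n → ℝ}
    (hy : y ∈ statSet X a₁ a₂) : (olsShape X R a₁ a₂ y).PosDef := by
  have h1 := posDef_conj (posDef_conj (posDef_conj (posDef_lambdaHat hy)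
    (mulVec_injective_of_rank hX)) (B := (Xᵀ * X)⁻¹)
    (Matrix.mulVec_injective_iff_isUnit.2 (posDef_gram hX).inv.isUnit))
    (mulVec_injective_of_rank (X := Rᵀ) (by rw [Matrix.rank_transpose, hR]))
  rw [Matrix.transpose_transpose, Matrix.transpose_nonsing_inv, Matrix.transpose_mul,
    Matrix.transpose_transpose] at h1
  simpa only [olsShape, Matrix.mul_assoc] using h1

lemma sigmaTildeSq_pos (hX : X.rank = k) (hkn : k < n) {y : Fin n → ℝ}
    (hy : y ∈ statSet X a₁ a₂) : 0 < sigmaTildeSq X a₁ a₂ y := by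
  have : (k : ℝ) < n := by exact_mod_cast hkn
  refine mul_pos (inv_pos.2 (by linarith)) ?_
  have h0 : y - X *ᵥ betaTilde X a₁ a₂ y ≠ 0 := by
    intro h
    refine resid_ne_zero_of_sqSum (sqSum_pos_of_mem_statSet hy).ne' ?_
    rw [sub_eq_zero.1 h, resid_mulVec hX]
  have := (posDef_lambdaHat hy).inv.dotProduct_mulVec_pos h0
  simpa using this

lemma notMem_excSet_of_mem_statSet (hX : X.rank = k) (hR : R.rank = q) (hkn : k < n)
    (κ : TestKind) {y : Fin n → ℝ} (hy : y ∈ statSet X a₁ a₂) : y ∉ excSet κ X R a₁ a₂ := by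
  cases κ
  · exact notMem_excSet_fgls.2 ⟨⟨ne_of_lt hy, (posDef_glsGram hX hy).det_pos.ne'⟩,
      (sigmaTildeSq_pos hX hkn hy).ne', (posDef_glsShape hX hR hy).det_pos.ne'⟩
  · exact notMem_excSet_ols.2 ⟨(sqSum_pos_of_mem_statSet hy).ne',
      (posDef_olsShape hX hR hy).det_pos.ne'⟩

/-- Restricting to `statSet` is essential: once |ρ̂| > 1 the matrix Λ(ρ̂) is no longer positive
definite, and the weight may fail to be so. This is how the constant K can fall below one. -/
lemma posDef_weight (hX : X.rank = k) (hR : R.rank = q) (hkn : k < n)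
    (κ : TestKind) {y : Fin n → ℝ} (hy : y ∈ statSet X a₁ a₂) :
    (weight κ X R a₁ a₂ y).PosDef := by
  cases κ
  · exact ((posDef_glsShape hX hR hy).smul (sigmaTildeSq_pos hX hkn hy)).inv
  · exact ((posDef_olsShape hX hR hy).smul (sigmaHatSq_pos hkn
      (resid_ne_zero_of_sqSum (sqSum_pos_of_mem_statSet hy).ne'))).inv

lemma weight_quad_pos (hX : X.rank = k) (hR : R.rank = q) (hkn : k < n)
    (κ : TestKind) {y : Fin n → ℝ} (hy : y ∈ statSet X a₁ a₂) {c : Fin q → ℝ} (hc : c ≠ 0) :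
    0 < c ⬝ᵥ (weight κ X R a₁ a₂ y *ᵥ c) := by
  simpa using (posDef_weight hX hR hkn κ hy).dotProduct_mulVec_pos hc

/-! ### The Yule-Walker estimator is less than one in modulus -/

/-- For s = ±1, twice (∑ u_i² + s ∑ u_{i+1} u_i) equals ∑ (u_{i+1} + s u_i)² + u_0². If this
vanished, then u_0 = 0 and u_{i+1} = -s u_i would propagate the zero to all i < n. -/
lemma abs_sum_lag_lt {n : ℕ} {u : ℕ → ℝ} (hn : u n = 0) (hu : ∃ i < n, u i ≠ 0) :
    |∑ i ∈ Finset.range n, u (i + 1) * u i| < ∑ i ∈ Finset.range n, u i ^ 2 := by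
  have key : ∀ s : ℝ, s ^ 2 = 1 →
      0 < ∑ i ∈ Finset.range n, u i ^ 2 + s * ∑ i ∈ Finset.range n, u (i + 1) * u i := by
    intro s hs
    have h1 : ∑ i ∈ Finset.range n, u (i + 1) ^ 2 = ∑ i ∈ Finset.range n, u i ^ 2 - u 0 ^ 2 := by
      have a := Finset.sum_range_succ (fun i => u i ^ 2) n
      have b := Finset.sum_range_succ' (fun i => u i ^ 2) n
      rw [hn] at a
      linarith
    have h2 : ∑ i ∈ Finset.range n, (u (i + 1) + s * u i) ^ 2 =
        ∑ i ∈ Finset.range n, u (i + 1) ^ 2 + ∑ i ∈ Finset.range n, u i ^ 2 +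
          2 * (s * ∑ i ∈ Finset.range n, u (i + 1) * u i) := by
      rw [Finset.mul_sum, Finset.mul_sum, ← Finset.sum_add_distrib, ← Finset.sum_add_distrib]
      refine Finset.sum_congr rfl fun i _ => ?_
      linear_combination u i ^ 2 * hs
    have h3 : 0 ≤ ∑ i ∈ Finset.range n, (u (i + 1) + s * u i) ^ 2 :=
      Finset.sum_nonneg fun i _ => sq_nonneg _
    by_contra hneg
    have h4 : ∑ i ∈ Finset.range n, (u (i + 1) + s * u i) ^ 2 = 0 := by
      nlinarith [sq_nonneg (u 0)]
    have h5 : u 0 = 0 := by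
      have : u 0 ^ 2 ≤ 0 := by linarith
      nlinarith [sq_nonneg (u 0)]
    have h6 := (Finset.sum_eq_zero_iff_of_nonneg (fun i _ => sq_nonneg _)).1 h4
    have h7 : ∀ i, i < n → u i = 0 := by
      intro i
      induction i with
      | zero => exact fun _ => h5
      | succ i ih =>
        intro hi
        have := h6 i (Finset.mem_range.2 (by omega))
        rw [ih (by omega), mul_zero, add_zero] at this
        exact pow_eq_zero_iff two_ne_zero |>.1 this
    obtain ⟨i, hi, hne⟩ := hu
    exact hne (h7 i hi)
  rw [abs_lt]
  constructor
  · linarith [key 1 (by norm_num)]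
  · linarith [key (-1) (by norm_num)]

lemma abs_sum_lag_fin_lt {n : ℕ} {u : Fin n → ℝ} (hu : u ≠ 0) :
    |∑ i : Fin n, ∑ j : Fin n, if (i : ℕ) = (j : ℕ) + 1 then u i * u j else 0| <
      ∑ i, u i ^ 2 := by
  set U : ℕ → ℝ := fun i => if h : i < n then u ⟨i, h⟩ else 0 with hU
  have hUi : ∀ i : Fin n, U i = u i := fun i => by simp [hU]
  have h1 : ∑ i, u i ^ 2 = ∑ i ∈ Finset.range n, U i ^ 2 := by
    rw [← Fin.sum_univ_eq_sum_range (fun i => U i ^ 2)]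
    simp only [hUi]
  have h2 : (∑ i : Fin n, ∑ j : Fin n, if (i : ℕ) = (j : ℕ) + 1 then u i * u j else 0) =
      ∑ i ∈ Finset.range n, U (i + 1) * U i := by
    rw [← Fin.sum_univ_eq_sum_range (fun i => U (i + 1) * U i), Finset.sum_comm]
    refine Finset.sum_congr rfl fun j _ => ?_
    by_cases hj : (j : ℕ) + 1 < n
    · rw [Finset.sum_eq_single ⟨(j : ℕ) + 1, hj⟩]
      · simp [hU, hj]
      · intro i _ hi
        rw [if_neg]
        intro h
        exact hi (Fin.ext h)
      · simp
    · rw [Finset.sum_eq_zero]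
      · simp [hU, hj]
      · intro i _
        rw [if_neg]
        intro h
        have := i.2
        omega
  rw [h1, h2]
  refine abs_sum_lag_lt (by simp [hU]) ?_
  obtain ⟨i, hi⟩ := Function.ne_iff.1 hu
  exact ⟨i, i.2, by rw [hUi]; exact hi⟩

lemma sqSum_full (y : Fin n → ℝ) : sqSum X 1 n y = ∑ i, resid X y i ^ 2 := by
  refine Finset.sum_congr rfl fun i _ => ?_
  rw [if_pos ⟨by omega, i.2⟩]

lemma mem_statSet_of_rhoHat_eq_rhoYW {y : Fin n → ℝ} (hy : y ∉ N0 X a₁ a₂)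
    (h : rhoHat X a₁ a₂ y = rhoYW X y) : y ∈ statSet X a₁ a₂ := by
  have h0 : sqSum X a₁ a₂ y ≠ 0 := hy
  have hp : 0 < sqSum X a₁ a₂ y := lt_of_le_of_ne (sqSum_nonneg y) h0.symm
  have h1 := abs_sum_lag_fin_lt (resid_ne_zero_of_sqSum h0)
  rw [← sqSum_full] at h1
  have h2 : |rhoYW X y| < 1 := by
    rw [rhoYW, rhoHat, abs_div, abs_of_nonneg (sqSum_nonneg y),
      div_lt_one ((abs_nonneg _).trans_lt h1)]
    exact h1
  rw [← h, rhoHat, abs_div, abs_of_pos hp, div_lt_one hp] at h2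
  exact h2

/-- Dimension count: vectors supported on [a, b) form a space of dimension b - a > k, and X' imposes
only k linear conditions. -/
lemma exists_supported_mem_ker (X : Matrix (Fin n) (Fin k) ℝ) {a b : ℕ} (hb : b ≤ n)
    (hab : k + a < b) : ∃ u : Fin n → ℝ, u ≠ 0 ∧ Xᵀ *ᵥ u = 0 ∧
      ∀ i : Fin n, ¬ (a ≤ (i : ℕ) ∧ (i : ℕ) < b) → u i = 0 := by
  let f : Fin (b - a) → Fin n := fun j => ⟨a + j, by omega⟩
  have hf : Function.Injective f := by
    intro i j h
    have : a + (i : ℕ) = a + j := congrArg Fin.val h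
    exact Fin.ext (by omega)
  let E : (Fin (b - a) → ℝ) →ₗ[ℝ] (Fin n → ℝ) := Fintype.linearCombination ℝ
    (fun j => Pi.single (f j) (1 : ℝ))
  have hE : ∀ z i, E z i = ∑ j, z j * (if i = f j then 1 else 0) := by
    intro z i
    simp [E, Fintype.linearCombination_apply, Pi.single_apply]
  have hker : LinearMap.ker (Xᵀ.mulVecLin ∘ₗ E) ≠ ⊥ := by
    apply LinearMap.ker_ne_bot_of_finrank_lt
    simp only [Module.finrank_fin_fun]
    omega
  obtain ⟨z, hz, hz0⟩ := Submodule.exists_mem_ne_zero_of_ne_bot hker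
  refine ⟨E z, ?_, hz, ?_⟩
  · intro h0
    apply hz0
    ext j
    have := congrFun h0 (f j)
    rw [hE] at this
    simpa [hf.eq_iff] using this
  · intro i hi
    rw [hE]
    refine Finset.sum_eq_zero fun j _ => ?_
    rw [if_neg, mul_zero]
    rintro rfl
    exact hi ⟨by simp [f], by simp only [f]; omega⟩

/-- A vector orthogonal to the columns of X is its own residual. If it is supported on the summation
range, the truncated denominator equals the full sum of squares, and the Yule-Walker bound applies.
-/
lemma statSet_nonempty (ha : IsAdmissible n k a₁ a₂) : (statSet X a₁ a₂).Nonempty := by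
  obtain ⟨h1, h2, h3, h4, h5⟩ := ha
  -- Time t has index t - 1, so the range is [a₁ - 1, a₂); the strict inequality k + (a₁ - 1) < a₂
  -- is the assumption k ≤ a₂ - a₁.
  obtain ⟨u, hu0, hu, hs⟩ := exists_supported_mem_ker X (a := a₁ - 1) (b := a₂) (by omega)
    (by omega)
  have hr : resid X u = u := by simp [resid, betaHat, hu]
  refine ⟨u, ?_⟩
  have h := abs_sum_lag_fin_lt hu0
  have h6 : sqSum X a₁ a₂ u = ∑ i, u i ^ 2 := by
    refine Finset.sum_congr rfl fun i _ => ?_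
    rw [hr]
    split_ifs with hc
    · rfl
    · rw [hs i (by omega)]; norm_num
  have h7 : lagSum X u =
      ∑ i : Fin n, ∑ j : Fin n, if (i : ℕ) = (j : ℕ) + 1 then u i * u j else 0 := by
    rw [lagSum, hr]
  change |lagSum X u| < sqSum X a₁ a₂ u
  rw [h6, h7]
  exact h

end Estimators

/-! ### Generically rational functions -/

/-- Fubini in the first coordinate: by induction the leading coefficient is nonzero for almost all
values of the others, so almost every section is a finite root set, which an atomless law does not
charge. -/
lemma stdNormal_zeroSet_eq_zero {n : ℕ} (p : MvPolynomial (Fin n) ℝ) (hp : p ≠ 0) :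
    stdNormal n {x | MvPolynomial.eval x p = 0} = 0 := by
  induction n with
  | zero =>
    obtain ⟨c, rfl⟩ := MvPolynomial.C_surjective (Fin 0) p
    have hc : c ≠ 0 := by rintro rfl; simp at hp
    simp [hc]
  | succ n ih =>
    set P := MvPolynomial.finSuccEquiv ℝ n p with hP
    have hP0 : P ≠ 0 := by
      rw [hP]; exact (map_ne_zero_iff _ (MvPolynomial.finSuccEquiv ℝ n).injective).2 hp
    have hmp := measurePreserving_piFinSuccAbove (fun _ : Fin (n + 1) => gaussianReal 0 1) 0
    have hcont : Continuous fun z : ℝ × (Fin n → ℝ) =>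
        MvPolynomial.eval (Fin.cons z.1 z.2 : Fin (n + 1) → ℝ) p := by
      refine (MvPolynomial.continuous_eval p).comp (continuous_pi fun i => ?_)
      refine Fin.cases ?_ (fun j => ?_) i
      · simpa using continuous_fst
      · exact (continuous_apply j).comp continuous_snd
    set B : Set (ℝ × (Fin n → ℝ)) :=
      {z | MvPolynomial.eval (Fin.cons z.1 z.2 : Fin (n + 1) → ℝ) p = 0} with hB
    have hBm : MeasurableSet B := (isClosed_eq hcont continuous_const).measurableSet
    have hpre : {x : Fin (n + 1) → ℝ | MvPolynomial.eval x p = 0} =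
        (MeasurableEquiv.piFinSuccAbove (fun _ : Fin (n + 1) => ℝ) 0) ⁻¹' B := by
      ext x
      simp only [hB, Set.mem_ofPred_eq, Set.mem_preimage, MeasurableEquiv.piFinSuccAbove_apply]
      rw [show (Fin.cons ((Fin.insertNthEquiv (fun _ => ℝ) 0).symm x).1
        ((Fin.insertNthEquiv (fun _ => ℝ) 0).symm x).2 : Fin (n + 1) → ℝ) = x from
          Fin.cons_self_tail x]
    rw [hpre, stdNormal, hmp.measure_preimage hBm.nullMeasurableSet,
      Measure.prod_apply_symm hBm, lintegral_eq_zero_iff (measurable_measure_prodMk_right hBm)]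
    have hlead : ∀ᵐ s ∂(stdNormal n), MvPolynomial.eval s P.leadingCoeff ≠ 0 := by
      simpa [ae_iff] using ih P.leadingCoeff (Polynomial.leadingCoeff_ne_zero.2 hP0)
    filter_upwards [hlead] with s hs
    have hmap : P.map (MvPolynomial.eval s) ≠ 0 := by
      intro h
      apply hs
      have := congrArg (fun f => Polynomial.coeff f P.natDegree) h
      simpa using this
    have hfin : ((fun x : ℝ => (x, s)) ⁻¹' B).Finite := by
      refine (P.map (MvPolynomial.eval s)).roots.toFinset.finite_toSet.subset fun a haB => ?_
      have : MvPolynomial.eval (Fin.cons a s : Fin (n + 1) → ℝ) p = 0 := haB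
      rw [MvPolynomial.eval_eq_eval_mv_eval'] at this
      simpa [hmap] using this
    have : NullSingletonClass (gaussianReal 0 1) := nullSingletonClass_gaussianReal one_ne_zero
    exact hfin.measure_zero _

lemma ae_eval_ne_zero {n : ℕ} {p : MvPolynomial (Fin n) ℝ} (hp : p ≠ 0) :
    ∀ᵐ x ∂(stdNormal n), MvPolynomial.eval x p ≠ 0 := by
  simpa [ae_iff] using stdNormal_zeroSet_eq_zero p hp

/-- A function that agrees with a quotient of two polynomials off the zero set of the
denominator. -/
def GenRat {n : ℕ} (f : (Fin n → ℝ) → ℝ) : Prop :=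
  ∃ p d : MvPolynomial (Fin n) ℝ, d ≠ 0 ∧
    ∀ x, MvPolynomial.eval x d ≠ 0 → f x = MvPolynomial.eval x p / MvPolynomial.eval x d

namespace GenRat

variable {n : ℕ} {f g : (Fin n → ℝ) → ℝ}

lemma const (c : ℝ) : GenRat (fun _ : Fin n → ℝ => c) :=
  ⟨MvPolynomial.C c, 1, one_ne_zero, fun x _ => by simp⟩

lemma coord (i : Fin n) : GenRat (fun x : Fin n → ℝ => x i) :=
  ⟨MvPolynomial.X i, 1, one_ne_zero, fun x _ => by simp⟩

lemma add (hf : GenRat f) (hg : GenRat g) : GenRat (fun x => f x + g x) := by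
  obtain ⟨p, d, hd, h⟩ := hf
  obtain ⟨p', d', hd', h'⟩ := hg
  refine ⟨p * d' + d * p', d * d', mul_ne_zero hd hd', fun x hx => ?_⟩
  rw [map_mul] at hx
  have h1 := left_ne_zero_of_mul hx
  have h2 := right_ne_zero_of_mul hx
  change f x + g x = _
  rw [h x h1, h' x h2, div_add_div _ _ h1 h2]
  simp only [map_add, map_mul]

lemma mul (hf : GenRat f) (hg : GenRat g) : GenRat (fun x => f x * g x) := by
  obtain ⟨p, d, hd, h⟩ := hf
  obtain ⟨p', d', hd', h'⟩ := hg
  refine ⟨p * p', d * d', mul_ne_zero hd hd', fun x hx => ?_⟩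
  rw [map_mul] at hx
  change f x * g x = _
  rw [h x (left_ne_zero_of_mul hx), h' x (right_ne_zero_of_mul hx), div_mul_div_comm]
  simp only [map_mul]

lemma inv (hf : GenRat f) : GenRat (fun x => (f x)⁻¹) := by
  obtain ⟨p, d, hd, h⟩ := hf
  by_cases hp : p = 0
  · refine ⟨0, d, hd, fun x hx => ?_⟩
    change (f x)⁻¹ = _
    rw [h x hx, hp]; simp
  -- The inverse d/p is expanded by d because f is only controlled where d does not vanish.
  · refine ⟨d * d, p * d, mul_ne_zero hp hd, fun x hx => ?_⟩
    rw [map_mul] at hx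
    have h1 := left_ne_zero_of_mul hx
    have h2 := right_ne_zero_of_mul hx
    change (f x)⁻¹ = _
    rw [h x h2, map_mul, map_mul]
    field_simp

lemma neg (hf : GenRat f) : GenRat (fun x => -f x) := by
  simpa using (const (-1)).mul hf

lemma sub (hf : GenRat f) (hg : GenRat g) : GenRat (fun x => f x - g x) := by
  simpa [sub_eq_add_neg] using hf.add hg.neg

lemma div (hf : GenRat f) (hg : GenRat g) : GenRat (fun x => f x / g x) := by
  simpa [div_eq_mul_inv] using hf.mul hg.inv

lemma pow (hf : GenRat f) (m : ℕ) : GenRat (fun x => f x ^ m) := by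
  induction m with
  | zero => simpa using const 1
  | succ m ih => simpa [pow_succ] using ih.mul hf

lemma sum {ι : Type*} (s : Finset ι) {F : ι → (Fin n → ℝ) → ℝ} (h : ∀ i ∈ s, GenRat (F i)) :
    GenRat (fun x => ∑ i ∈ s, F i x) := by
  classical
  induction s using Finset.induction_on with
  | empty => simpa using const 0
  | insert a s ha ih =>
    simp only [Finset.sum_insert ha]
    exact (h a (Finset.mem_insert_self a s)).add
      (ih fun i hi => h i (Finset.mem_insert_of_mem hi))

lemma prod {ι : Type*} (s : Finset ι) {F : ι → (Fin n → ℝ) → ℝ} (h : ∀ i ∈ s, GenRat (F i)) :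
    GenRat (fun x => ∏ i ∈ s, F i x) := by
  classical
  induction s using Finset.induction_on with
  | empty => simpa using const 1
  | insert a s ha ih =>
    simp only [Finset.prod_insert ha]
    exact (h a (Finset.mem_insert_self a s)).mul
      (ih fun i hi => h i (Finset.mem_insert_of_mem hi))

/-- A generically rational function that has no zero in some nonempty open set is nonzero almost
everywhere. -/
lemma ae_ne_zero (hf : GenRat f) {O : Set (Fin n → ℝ)} (hO : IsOpen O) (hne : O.Nonempty)
    (h0 : ∀ x ∈ O, f x ≠ 0) : ∀ᵐ x ∂(stdNormal n), f x ≠ 0 := by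
  obtain ⟨p, d, hd, h⟩ := hf
  have hdae : ∀ᵐ x ∂(stdNormal n), MvPolynomial.eval x d ≠ 0 := ae_eval_ne_zero hd
  -- Otherwise f would be 0 off the zeros of d, so the open set O, which has positive measure, would
  -- lie in that null set.
  have hp : p ≠ 0 := by
    rintro rfl
    have hsub : O ⊆ {x | MvPolynomial.eval x d = 0} := by
      intro x hx
      by_contra hxd
      exact h0 x hx (by rw [h x hxd]; simp)
    exact hO.measure_ne_zero (stdNormal n) hne
      (measure_mono_null hsub (stdNormal_zeroSet_eq_zero d hd))
  have hpae : ∀ᵐ x ∂(stdNormal n), MvPolynomial.eval x p ≠ 0 := ae_eval_ne_zero hp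
  filter_upwards [hdae, hpae] with x hx1 hx2
  rw [h x hx1]
  exact div_ne_zero hx2 hx1

variable {l m k : ℕ}

lemma dotProduct {u v : (Fin n → ℝ) → Fin m → ℝ} (hu : ∀ i, GenRat fun x => u x i)
    (hv : ∀ i, GenRat fun x => v x i) : GenRat (fun x => u x ⬝ᵥ v x) :=
  sum _ fun i _ => (hu i).mul (hv i)

lemma mulVec {A : (Fin n → ℝ) → Matrix (Fin l) (Fin m) ℝ} {v : (Fin n → ℝ) → Fin m → ℝ}
    (hA : ∀ i j, GenRat fun x => A x i j) (hv : ∀ i, GenRat fun x => v x i) (i : Fin l) :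
    GenRat (fun x => (A x *ᵥ v x) i) :=
  dotProduct (fun j => hA i j) hv

lemma matrix_mul {A : (Fin n → ℝ) → Matrix (Fin l) (Fin m) ℝ}
    {B : (Fin n → ℝ) → Matrix (Fin m) (Fin k) ℝ}
    (hA : ∀ i j, GenRat fun x => A x i j) (hB : ∀ i j, GenRat fun x => B x i j) (i : Fin l)
    (j : Fin k) : GenRat (fun x => (A x * B x) i j) := by
  simp only [Matrix.mul_apply]
  exact sum _ fun s _ => (hA i s).mul (hB s j)

lemma const_mulVec (M : Matrix (Fin l) (Fin m) ℝ) {v : (Fin n → ℝ) → Fin m → ℝ}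
    (hv : ∀ i, GenRat fun x => v x i) (i : Fin l) : GenRat (fun x => (M *ᵥ v x) i) :=
  mulVec (A := fun _ => M) (fun a b => const (M a b)) hv i

lemma const_mul (M : Matrix (Fin l) (Fin m) ℝ) {B : (Fin n → ℝ) → Matrix (Fin m) (Fin k) ℝ}
    (hB : ∀ i j, GenRat fun x => B x i j) (i : Fin l) (j : Fin k) :
    GenRat (fun x => (M * B x) i j) :=
  matrix_mul (A := fun _ => M) (fun a b => const (M a b)) hB i j

lemma mul_const {A : (Fin n → ℝ) → Matrix (Fin l) (Fin m) ℝ}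
    (hA : ∀ i j, GenRat fun x => A x i j) (M : Matrix (Fin m) (Fin k) ℝ) (i : Fin l) (j : Fin k) :
    GenRat (fun x => (A x * M) i j) :=
  matrix_mul (B := fun _ => M) hA (fun a b => const (M a b)) i j

lemma det {A : (Fin n → ℝ) → Matrix (Fin m) (Fin m) ℝ}
    (hA : ∀ i j, GenRat fun x => A x i j) : GenRat (fun x => (A x).det) := by
  simp only [Matrix.det_apply']
  exact sum _ fun s _ => (const _).mul (prod _ fun i _ => hA _ _)

lemma matrix_inv {A : (Fin n → ℝ) → Matrix (Fin m) (Fin m) ℝ}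
    (hA : ∀ i j, GenRat fun x => A x i j) (i j : Fin m) : GenRat (fun x => (A x)⁻¹ i j) := by
  simp only [Matrix.inv_def, Ring.inverse_eq_inv', Matrix.smul_apply, smul_eq_mul,
    Matrix.adjugate_apply]
  refine (det hA).inv.mul (det fun a b => ?_)
  simp only [Matrix.updateRow_apply]
  split_ifs
  · exact const _
  · exact hA a b

end GenRat

/-! ### Generic rationality of the estimators and almost sure avoidance of degenerate samples. -/

section Estimators

variable {n k q : ℕ} {X : Matrix (Fin n) (Fin k) ℝ} {R : Matrix (Fin q) (Fin k) ℝ}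
  {a₁ a₂ : ℕ} {v : (Fin n → ℝ) → Fin n → ℝ}

lemma GenRat.betaHat (hv : ∀ i, GenRat fun x => v x i) (j : Fin k) :
    GenRat (fun x => AutocorrTest.betaHat X (v x) j) :=
  GenRat.const_mulVec _ (GenRat.const_mulVec _ hv) j

lemma GenRat.resid (hv : ∀ i, GenRat fun x => v x i) (j : Fin n) :
    GenRat (fun x => AutocorrTest.resid X (v x) j) :=
  (hv j).sub (GenRat.const_mulVec _ (GenRat.betaHat hv) j)

lemma GenRat.lagSum (hv : ∀ i, GenRat fun x => v x i) :
    GenRat (fun x => AutocorrTest.lagSum X (v x)) := by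
  refine GenRat.sum _ fun i _ => GenRat.sum _ fun j _ => ?_
  split_ifs
  · exact (GenRat.resid hv i).mul (GenRat.resid hv j)
  · exact .const 0

lemma GenRat.sqSum (hv : ∀ i, GenRat fun x => v x i) :
    GenRat (fun x => AutocorrTest.sqSum X a₁ a₂ (v x)) := by
  refine GenRat.sum _ fun i _ => ?_
  split_ifs
  · exact (GenRat.resid hv i).pow 2
  · exact .const 0

lemma GenRat.lambdaHat (hv : ∀ i, GenRat fun x => v x i) (i j : Fin n) :
    GenRat (fun x => AutocorrTest.lambdaHat X a₁ a₂ (v x) i j) :=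
  ((GenRat.lagSum hv).div (GenRat.sqSum hv)).pow _

lemma GenRat.glsGram (hv : ∀ i, GenRat fun x => v x i) (i j : Fin k) :
    GenRat (fun x => AutocorrTest.glsGram X a₁ a₂ (v x) i j) :=
  GenRat.mul_const (GenRat.const_mul _ (GenRat.matrix_inv (GenRat.lambdaHat hv))) _ i j

lemma GenRat.betaTilde (hv : ∀ i, GenRat fun x => v x i) (j : Fin k) :
    GenRat (fun x => AutocorrTest.betaTilde X a₁ a₂ (v x) j) :=
  GenRat.mulVec (GenRat.matrix_inv (GenRat.glsGram hv))
    (GenRat.const_mulVec _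
      (GenRat.mulVec (GenRat.matrix_inv (GenRat.lambdaHat hv)) hv)) j

lemma GenRat.sigmaTildeSq (hv : ∀ i, GenRat fun x => v x i) :
    GenRat (fun x => AutocorrTest.sigmaTildeSq X a₁ a₂ (v x)) := by
  have h : ∀ i, GenRat fun x => (v x - X *ᵥ AutocorrTest.betaTilde X a₁ a₂ (v x)) i :=
    fun i => (hv i).sub (GenRat.const_mulVec _ (GenRat.betaTilde hv) i)
  exact (GenRat.const _).mul
    (GenRat.dotProduct h (GenRat.mulVec (GenRat.matrix_inv (GenRat.lambdaHat hv)) h))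

lemma GenRat.glsShape (hv : ∀ i, GenRat fun x => v x i) (i j : Fin q) :
    GenRat (fun x => AutocorrTest.glsShape X R a₁ a₂ (v x) i j) :=
  GenRat.mul_const (GenRat.const_mul _ (GenRat.matrix_inv (GenRat.glsGram hv))) _ i j

lemma GenRat.sigmaHatSq (hv : ∀ i, GenRat fun x => v x i) :
    GenRat (fun x => AutocorrTest.sigmaHatSq X (v x)) :=
  (GenRat.const _).mul (GenRat.dotProduct (GenRat.resid hv) (GenRat.resid hv))

lemma GenRat.olsShape (hv : ∀ i, GenRat fun x => v x i) (i j : Fin q) :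
    GenRat (fun x => AutocorrTest.olsShape X R a₁ a₂ (v x) i j) :=
  GenRat.mul_const (GenRat.mul_const (GenRat.mul_const (GenRat.const_mul _
    (GenRat.lambdaHat hv)) _) _) _ i j

lemma GenRat.weight (κ : TestKind) (hv : ∀ i, GenRat fun x => v x i) (i j : Fin q) :
    GenRat (fun x => AutocorrTest.weight κ X R a₁ a₂ (v x) i j) := by
  cases κ
  · exact GenRat.matrix_inv (fun a b => (GenRat.sigmaTildeSq hv).mul (GenRat.glsShape hv a b)) i j
  · exact GenRat.matrix_inv (fun a b => (GenRat.sigmaHatSq hv).mul (GenRat.olsShape hv a b)) i j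

/-- A random vector that depends linearly on the innovations and takes values with a stationary
autoregressive estimate avoids the exceptional set almost surely. -/
lemma ae_notMem_excSet (hX : X.rank = k) (hR : R.rank = q) (hkn : k < n) (κ : TestKind)
    (hv : ∀ i, GenRat fun x => v x i) (hvc : Continuous v)
    (hne : ∃ x, v x ∈ statSet X a₁ a₂) :
    ∀ᵐ x ∂(stdNormal n), v x ∉ excSet κ X R a₁ a₂ := by
  have hO := (isOpen_statSet (X := X) (a₁ := a₁) (a₂ := a₂)).preimage hvc
  cases κ
  -- The difference of squares replaces |lagSum| = sqSum by an equation without absolute values.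
  · have h1 := (((GenRat.sqSum (X := X) (a₁ := a₁) (a₂ := a₂) hv).pow 2).sub
      ((GenRat.lagSum (X := X) hv).pow 2)).ae_ne_zero hO hne (fun x hx => by
        have : |AutocorrTest.lagSum X (v x)| < AutocorrTest.sqSum X a₁ a₂ (v x) := hx
        rw [← sq_abs (AutocorrTest.lagSum X (v x))]
        nlinarith [abs_nonneg (AutocorrTest.lagSum X (v x))])
    have h2 := (GenRat.det (A := fun x => AutocorrTest.glsGram X a₁ a₂ (v x))
      (GenRat.glsGram hv)).ae_ne_zero hO hne
      (fun x hx => (posDef_glsGram hX hx).det_pos.ne')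
    have h3 := (GenRat.sigmaTildeSq (X := X) (a₁ := a₁) (a₂ := a₂) hv).ae_ne_zero hO hne
      (fun x hx => (sigmaTildeSq_pos hX hkn hx).ne')
    have h4 := (GenRat.det (A := fun x => AutocorrTest.glsShape X R a₁ a₂ (v x))
      (GenRat.glsShape hv)).ae_ne_zero hO hne (fun x hx => (posDef_glsShape hX hR hx).det_pos.ne')
    filter_upwards [h1, h2, h3, h4] with x g1 g2 g3 g4
    refine notMem_excSet_fgls.2 ⟨⟨fun h => g1 ?_, g2⟩, g3, g4⟩
    have h : |AutocorrTest.lagSum X (v x)| = AutocorrTest.sqSum X a₁ a₂ (v x) := h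
    rw [← h, sq_abs, sub_self]
  · have h1 := (GenRat.sqSum (X := X) (a₁ := a₁) (a₂ := a₂) hv).ae_ne_zero hO hne
      fun x hx => by
        have h : 0 < AutocorrTest.sqSum X a₁ a₂ (v x) := sqSum_pos_of_mem_statSet (y := v x) hx
        exact h.ne'
    have h2 := (GenRat.det (A := fun x => AutocorrTest.olsShape X R a₁ a₂ (v x))
      (GenRat.olsShape hv)).ae_ne_zero hO hne fun x hx => by
        have h : (AutocorrTest.olsShape X R a₁ a₂ (v x)).PosDef := posDef_olsShape (y := v x) hX hR hx
        exact h.det_pos.ne'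
    filter_upwards [h1, h2] with x g1 g2
    exact notMem_excSet_ols.2 ⟨g1, g2⟩

/-- This excludes the borderline case of a vanishing form, in which the growth of the statistic
would be undetermined. -/
lemma ae_weight_quad_ne_zero (hX : X.rank = k) (hR : R.rank = q) (hkn : k < n) (κ : TestKind)
    (hv : ∀ i, GenRat fun x => v x i) (hvc : Continuous v)
    (hne : ∃ x, v x ∈ statSet X a₁ a₂) {c : Fin q → ℝ} (hc : c ≠ 0) :
    ∀ᵐ x ∂(stdNormal n), c ⬝ᵥ (weight κ X R a₁ a₂ (v x) *ᵥ c) ≠ 0 := by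
  have h1 : ∀ i, GenRat fun x => (weight κ X R a₁ a₂ (v x) *ᵥ c) i :=
    GenRat.mulVec (A := fun x => weight κ X R a₁ a₂ (v x)) (v := fun _ => c)
      (GenRat.weight κ hv) (fun i => .const (c i))
  have h2 : GenRat fun x => c ⬝ᵥ (weight κ X R a₁ a₂ (v x) *ᵥ c) :=
    GenRat.dotProduct (u := fun _ => c) (fun i => .const (c i)) h1
  have hO := (isOpen_statSet (X := X) (a₁ := a₁) (a₂ := a₂)).preimage hvc
  exact h2.ae_ne_zero hO hne fun x hx => by
    have h : 0 < c ⬝ᵥ (weight κ X R a₁ a₂ (v x) *ᵥ c) :=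
      weight_quad_pos (y := v x) hX hR hkn κ hx hc
    exact h.ne'

end Estimators

open Filter

/-! ### Paths near the unit root -/

section Paths

variable {n : ℕ}

/-- The innovation of the first observation. -/
def firstCoord (ξ : Fin n → ℝ) : ℝ := ∑ j : Fin n, if (j : ℕ) = 0 then ξ j else 0

/-- The rescaled deviation of the stationary path from its limit as the autoregressive parameter
tends to the unit root. -/
def pathDev (e : Fin n → ℝ) (t : ℝ) (ξ : Fin n → ℝ) : Fin n → ℝ := fun i =>
  e i * ((-t * ∑ l ∈ Finset.range i, arParam t ^ l) * firstCoord ξ +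
    ∑ j : Fin n, if 1 ≤ (j : ℕ) ∧ (j : ℕ) ≤ i then arParam t ^ ((i : ℕ) - j) * ξ j else 0)

/-- The first innovation enters with weight ρ^i = 1 - (1 - ρ) ∑ ρ^l = 1 - t c ∑ ρ^l, and all later
ones carry the factor c; so everything beyond ξ₁ e is divisible by c. -/
lemma arFactor_mulVec (e : Fin n → ℝ) (t : ℝ) (ξ : Fin n → ℝ) :
    arFactor e t *ᵥ ξ = firstCoord ξ • e + arScale t • pathDev e t ξ := by
  ext i
  have hgeom : arParam t ^ (i : ℕ) =
      1 - t * arScale t * ∑ l ∈ Finset.range i, arParam t ^ l := by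
    have := mul_neg_geom_sum (arParam t) (i : ℕ)
    rw [one_sub_arParam] at this
    linarith
  simp only [Matrix.mulVec, dotProduct, Pi.add_apply, Pi.smul_apply, smul_eq_mul, pathDev,
    firstCoord]
  rw [Finset.sum_mul, Finset.mul_sum, ← Finset.sum_add_distrib, Finset.mul_sum, Finset.mul_sum,
    ← Finset.sum_add_distrib]
  refine Finset.sum_congr rfl fun j _ => ?_
  simp only [arFactor, arLower, Matrix.of_apply]
  by_cases h0 : (j : ℕ) = 0
  · simp only [h0, Nat.zero_le, if_true, Nat.sub_zero, mul_one, hgeom, nonpos_iff_eq_zero,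
      one_ne_zero, false_and, if_false]
    ring
  · have h1 : 1 ≤ (j : ℕ) := by omega
    simp only [h0, h1, true_and, if_false]
    split_ifs <;> ring

lemma continuous_pathDev_left (e : Fin n → ℝ) (ξ : Fin n → ℝ) :
    Continuous fun t => pathDev e t ξ := by
  have := continuous_arParam
  refine continuous_pi fun i => ?_
  unfold pathDev
  refine continuous_const.mul (Continuous.add (by fun_prop)
    (continuous_finsetSum _ fun j _ => ?_))
  split_ifs <;> fun_prop

lemma continuous_pathDev_right (e : Fin n → ℝ) (t : ℝ) : Continuous (pathDev e t) := by
  refine continuous_pi fun i => ?_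
  unfold pathDev firstCoord
  refine continuous_const.mul (Continuous.add (continuous_const.mul
    (continuous_finsetSum _ fun j _ => ?_)) (continuous_finsetSum _ fun j _ => ?_))
  all_goals split_ifs <;> fun_prop

lemma genRat_pathDev (e : Fin n → ℝ) (t : ℝ) (i : Fin n) :
    GenRat fun ξ => pathDev e t ξ i := by
  refine (GenRat.const _).mul (((GenRat.const _).mul (GenRat.sum _ fun j _ => ?_)).add
    (GenRat.sum _ fun j _ => ?_))
  · split_ifs
    · exact .coord j
    · exact .const 0
  · split_ifs
    · exact (GenRat.const _).mul (.coord j)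
    · exact .const 0

lemma continuous_arFactor_mulVec (e : Fin n → ℝ) (ξ : Fin n → ℝ) :
    Continuous fun t => arFactor e t *ᵥ ξ := by
  have h1 := continuous_pathDev_left e ξ
  have h2 := continuous_arScale
  simp only [arFactor_mulVec]
  fun_prop

lemma arScale_zero : arScale 0 = 0 := by simp [arScale]

lemma arFactor_zero_mulVec (e : Fin n → ℝ) (ξ : Fin n → ℝ) :
    arFactor e 0 *ᵥ ξ = firstCoord ξ • e := by
  rw [arFactor_mulVec, arScale_zero, zero_smul, add_zero]

lemma ae_firstCoord_ne_zero (hn : 0 < n) : ∀ᵐ ξ ∂(stdNormal n), firstCoord ξ ≠ 0 := by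
  have hg : GenRat (firstCoord (n := n)) := by
    refine GenRat.sum _ fun j _ => ?_
    split_ifs
    · exact .coord j
    · exact .const 0
  have hc : Continuous (firstCoord (n := n)) := by
    refine continuous_finsetSum _ fun j _ => ?_
    split_ifs <;> fun_prop
  refine hg.ae_ne_zero (isOpen_ne_fun hc continuous_const) ⟨fun _ => 1, ?_⟩ fun x hx => hx
  change (∑ j : Fin n, if (j : ℕ) = 0 then (1 : ℝ) else 0) ≠ 0
  rw [Finset.sum_eq_single (⟨0, hn⟩ : Fin n)]
  · simp
  · intro b _ hb
    rw [if_neg]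
    exact fun h => hb (Fin.ext h)
  · simp

/-- At t = 0 the deviation is e times a random walk started at zero. Taking the increments of e_j
y_j as innovations recovers y up to its starting value, which is a multiple of e. -/
lemma exists_pathDev_zero_eq {e : Fin n → ℝ} (he : ∀ i, e i * e i = 1) (y : Fin n → ℝ) :
    ∃ ξ : Fin n → ℝ, ∃ a : ℝ, pathDev e 0 ξ = y + a • e := by
  set Y : ℕ → ℝ := fun j => if h : j < n then e ⟨j, h⟩ * y ⟨j, h⟩ else 0 with hY
  have hYi : ∀ i : Fin n, Y i = e i * y i := fun i => by simp [hY]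
  -- At j = 0 the truncated subtraction gives 0; this innovation has no influence, its coefficient
  -- being zero at t = 0.
  refine ⟨fun j => Y j - Y (j - 1), -Y 0, ?_⟩
  ext i
  have hsum : (∑ j : Fin n, if 1 ≤ (j : ℕ) ∧ (j : ℕ) ≤ i then Y j - Y (j - 1) else 0) =
      Y i - Y 0 := by
    rw [Fin.sum_univ_eq_sum_range
      (fun j => if 1 ≤ j ∧ j ≤ (i : ℕ) then Y j - Y (j - 1) else 0) n]
    have hsub : Finset.range ((i : ℕ) + 1) ⊆ Finset.range n := by
      intro s hs
      have := Finset.mem_range.1 hs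
      exact Finset.mem_range.2 (by omega)
    rw [← Finset.sum_subset hsub, Finset.sum_range_succ']
    · simp only [nonpos_iff_eq_zero, one_ne_zero, false_and, if_false, add_zero]
      refine Eq.trans ?_ (Finset.sum_range_sub Y i)
      refine Finset.sum_congr rfl fun j hj => ?_
      have := Finset.mem_range.1 hj
      rw [if_pos ⟨by omega, by omega⟩, Nat.add_sub_cancel]
    · intro s _ hs
      rw [if_neg]
      rintro ⟨-, h⟩
      exact hs (Finset.mem_range.2 (by omega))
  have h1 : arParam 0 = 1 := by simp [arParam]
  simp only [pathDev, h1, one_pow, one_mul, neg_zero, zero_mul, zero_add, hsum, Pi.add_apply,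
    Pi.smul_apply, smul_eq_mul]
  rw [hYi]
  linear_combination y i * he i

/-- Bounded convergence of indicators: with the innovations held fixed, it is enough to know for
almost every ξ on which side the decision finally settles. -/
lemma tendsto_gaussianLaw {e : Fin n → ℝ} {t : ℕ → ℝ} {μ : ℕ → Fin n → ℝ} {σ : ℝ}
    {W A : Set (Fin n → ℝ)} (hW : MeasurableSet W) (hA : MeasurableSet A)
    (h : ∀ᵐ ξ ∂(stdNormal n), ∀ᶠ m in atTop, (μ m + σ • (arFactor e (t m) *ᵥ ξ) ∈ W ↔ ξ ∈ A)) :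
    Tendsto (fun m => gaussianLaw (μ m) (σ ^ 2 • (arFactor e (t m) * (arFactor e (t m))ᵀ)) W)
      atTop (𝓝 (stdNormal n A)) := by
  simp only [gaussianLaw_apply _ _ _ hW]
  refine tendsto_measure_of_ae_tendsto_indicator_of_isFiniteMeasure atTop hA (fun m => ?_) h
  have : Continuous fun ξ : Fin n → ℝ => μ m + σ • (arFactor e (t m) *ᵥ ξ) := by fun_prop
  exact this.measurable hW

/-- A sequence of positive numbers that tends to zero. -/
def nullSeq (m : ℕ) : ℝ := 1 / ((m : ℝ) + 1)

lemma nullSeq_pos (m : ℕ) : 0 < nullSeq m := Nat.one_div_pos_of_nat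

lemma tendsto_nullSeq : Tendsto nullSeq atTop (𝓝 0) := tendsto_one_div_add_atTop_nhds_zero_nat

end Paths

/-! ### Limits of rejection probabilities when e is not exceptional; positivity of the size. -/

section Tests

variable {n k q : ℕ} {X : Matrix (Fin n) (Fin k) ℝ} {R : Matrix (Fin q) (Fin k) ℝ}
  {a₁ a₂ : ℕ} {r : Fin q → ℝ}

/-- The right-hand side involves neither s nor μ, so T is constant along the punctured limiting line
and the same for all null means. -/
lemma stat_smul_add_null (hX : X.rank = k) (κ : TestKind) {s : ℝ} (hs : s ≠ 0) {y : Fin n → ℝ}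
    (hy : y ∉ excSet κ X R a₁ a₂) {μ : Fin n → ℝ} (hμ : μ ∈ nullMeans X R r) :
    stat κ X R r a₁ a₂ (s • y + μ) = (R *ᵥ coefEst κ X a₁ a₂ y) ⬝ᵥ
      (weight κ X R a₁ a₂ y *ᵥ (R *ᵥ coefEst κ X a₁ a₂ y)) := by
  obtain ⟨β, rfl, hβ⟩ := hμ
  rw [stat_smul_add hX κ r hs β hy, hβ, sub_self, smul_zero, add_zero]

/-- Invariance of the test statistic under dilations centred at an element of the null
hypothesis. -/
lemma stat_dilation (hX : X.rank = k) (κ : TestKind) {s : ℝ} (hs : s ≠ 0) (y : Fin n → ℝ)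
    {μ : Fin n → ℝ} (hμ : μ ∈ nullMeans X R r) :
    stat κ X R r a₁ a₂ (s • y + (1 - s) • μ) = stat κ X R r a₁ a₂ y := by
  obtain ⟨β, rfl, hβ⟩ := hμ
  rw [← Matrix.mulVec_smul]
  by_cases hy : y ∈ excSet κ X R a₁ a₂
  · rw [stat_of_mem r hy, stat_of_mem r ((mem_excSet_smul_add hX κ hs y _).2 hy)]
  · rw [stat_smul_add hX κ r hs _ hy, stat_of_notMem r hy, Matrix.mulVec_smul, hβ]
    have : s⁻¹ • ((1 - s) • r - r) = -r := by
      ext i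
      simp only [Pi.smul_apply, Pi.sub_apply, smul_eq_mul, Pi.neg_apply]
      field_simp
      ring
    rw [this, sub_eq_add_neg]

lemma nullMeans_nonempty (hR : R.rank = q) : (nullMeans X R r).Nonempty := by
  obtain ⟨β, hβ⟩ := mulVec_surjective_of_rank hR r
  exact ⟨_, β, rfl, hβ⟩

lemma add_smul_mem_altMeans (hX : X.rank = k) {μ : Fin n → ℝ} (hμ : μ ∈ nullMeans X R r)
    {δ : Fin k → ℝ} (hδ : R *ᵥ δ ≠ 0) {γ : ℝ} (hγ : γ ≠ 0) :
    μ + γ • (X *ᵥ δ) ∈ altMeans X R r := by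
  obtain ⟨β, rfl, hβ⟩ := hμ
  have h : X *ᵥ β + γ • (X *ᵥ δ) = X *ᵥ (β + γ • δ) := by
    rw [Matrix.mulVec_add, Matrix.mulVec_smul]
  refine ⟨⟨_, h⟩, ?_⟩
  rintro ⟨β', h1, h2⟩
  rw [h] at h1
  have h3 := mulVec_injective_of_rank hX h1
  rw [← h3, Matrix.mulVec_add, Matrix.mulVec_smul, hβ, add_eq_left] at h2
  exact (smul_ne_zero hγ hδ) h2

lemma exists_mulVec_ne_zero (hR : R.rank = q) (hq : 1 ≤ q) : ∃ δ, R *ᵥ δ ≠ 0 := by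
  obtain ⟨δ, hδ⟩ := mulVec_surjective_of_rank hR (fun _ => 1)
  refine ⟨δ, ?_⟩
  rw [hδ]
  exact fun h => one_ne_zero (congrFun h ⟨0, hq⟩)

lemma tendsto_path (e : Fin n → ℝ) (ξ : Fin n → ℝ) {μ : ℕ → Fin n → ℝ} {μ₀ : Fin n → ℝ}
    (hμ : Tendsto μ atTop (𝓝 μ₀)) (σ : ℝ) :
    Tendsto (fun m => μ m + σ • (arFactor e (nullSeq m) *ᵥ ξ)) atTop
      (𝓝 ((σ * firstCoord ξ) • e + μ₀)) := by
  have h := ((continuous_arFactor_mulVec e ξ).tendsto 0).comp tendsto_nullSeq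
  rw [arFactor_zero_mulVec] at h
  have := hμ.add (h.const_smul σ)
  rwa [smul_smul, add_comm μ₀] at this

/-- Almost surely the limit σ ξ₁ e + μ₀ of the path has ξ₁ ≠ 0, hence is a continuity point of the
statistic with value T(e + μ₀) > C. The means may vary with m, so the limit is uniform enough for
local alternatives. -/
lemma tendsto_gaussianLaw_one
    (hX : X.rank = k) (ha : IsAdmissible n k a₁ a₂) {κ : TestKind} {e : Fin n → ℝ}
    (he : e ∉ excSet κ X R a₁ a₂) {C : ℝ} (hC : 0 < C) {μ : ℕ → Fin n → ℝ} {μ₀ : Fin n → ℝ}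
    (hμ₀ : μ₀ ∈ nullMeans X R r) (hμ : Tendsto μ atTop (𝓝 μ₀)) {σ : ℝ} (hσ : 0 < σ)
    (hT : C < stat κ X R r a₁ a₂ (e + μ₀)) :
    Tendsto (fun m => gaussianLaw (μ m)
      (σ ^ 2 • (arFactor e (nullSeq m) * (arFactor e (nullSeq m))ᵀ))
        (rejRegion κ X R r a₁ a₂ C)) atTop (𝓝 1) := by
  rw [← measure_univ (μ := stdNormal n)]
  refine tendsto_gaussianLaw (measurableSet_rejRegion ha κ r hC) MeasurableSet.univ ?_
  filter_upwards [ae_firstCoord_ne_zero (n := n) (by have := ha.2.2.2.2; omega)] with ξ hξ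
  obtain ⟨β, rfl, hβ⟩ := hμ₀
  have hs : σ * firstCoord ξ ≠ 0 := mul_ne_zero hσ.ne' hξ
  have hc := continuousAt_stat ha κ r (notMem_excSet_smul_add hX κ hs β he)
  have hlim := hc.tendsto.comp (tendsto_path e ξ hμ σ)
  rw [stat_smul_add_null hX κ hs he ⟨β, rfl, hβ⟩,
    ← stat_smul_add_null hX κ one_ne_zero he ⟨β, rfl, hβ⟩, one_smul] at hlim
  filter_upwards [hlim.eventually_const_lt hT] with m hm
  exact iff_of_true (le_of_lt hm) (Set.mem_univ _)

lemma tendsto_gaussianLaw_zero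
    (hX : X.rank = k) (ha : IsAdmissible n k a₁ a₂) {κ : TestKind} {e : Fin n → ℝ}
    (he : e ∉ excSet κ X R a₁ a₂) {C : ℝ} (hC : 0 < C) {μ : ℕ → Fin n → ℝ} {μ₀ : Fin n → ℝ}
    (hμ₀ : μ₀ ∈ nullMeans X R r) (hμ : Tendsto μ atTop (𝓝 μ₀)) {σ : ℝ} (hσ : 0 < σ)
    (hT : stat κ X R r a₁ a₂ (e + μ₀) < C) :
    Tendsto (fun m => gaussianLaw (μ m)
      (σ ^ 2 • (arFactor e (nullSeq m) * (arFactor e (nullSeq m))ᵀ))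
        (rejRegion κ X R r a₁ a₂ C)) atTop (𝓝 0) := by
  rw [← measure_empty (μ := stdNormal n)]
  refine tendsto_gaussianLaw (measurableSet_rejRegion ha κ r hC) MeasurableSet.empty ?_
  filter_upwards [ae_firstCoord_ne_zero (n := n) (by have := ha.2.2.2.2; omega)] with ξ hξ
  obtain ⟨β, rfl, hβ⟩ := hμ₀
  have hs : σ * firstCoord ξ ≠ 0 := mul_ne_zero hσ.ne' hξ
  have hc := continuousAt_stat ha κ r (notMem_excSet_smul_add hX κ hs β he)
  have hlim := hc.tendsto.comp (tendsto_path e ξ hμ σ)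
  rw [stat_smul_add_null hX κ hs he ⟨β, rfl, hβ⟩,
    ← stat_smul_add_null hX κ one_ne_zero he ⟨β, rfl, hβ⟩, one_smul] at hlim
  filter_upwards [hlim.eventually_lt_const hT] with m hm
  exact iff_of_false (not_le_of_gt hm) (Set.notMem_empty _)

/-- Trades a large variance for a small departure from the null: a dilation about μ₀ does not change
the statistic. -/
lemma gaussianLaw_rejRegion_dilation (hX : X.rank = k) (ha : IsAdmissible n k a₁ a₂)
    (κ : TestKind) {C : ℝ} (hC : 0 < C) {μ₀ : Fin n → ℝ} (hμ₀ : μ₀ ∈ nullMeans X R r)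
    (ν : Fin n → ℝ) {s : ℝ} (hs : 0 < s) (F : Matrix (Fin n) (Fin n) ℝ) :
    gaussianLaw (μ₀ + ν) (s ^ 2 • (F * Fᵀ)) (rejRegion κ X R r a₁ a₂ C) =
      gaussianLaw (μ₀ + s⁻¹ • ν) ((1 : ℝ) ^ 2 • (F * Fᵀ)) (rejRegion κ X R r a₁ a₂ C) := by
  have hW := measurableSet_rejRegion (X := X) (R := R) ha κ r hC
  rw [gaussianLaw_apply _ _ _ hW, gaussianLaw_apply _ _ _ hW]
  congr 1
  ext ξ
  have : μ₀ + ν + s • (F *ᵥ ξ) =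
      s • (μ₀ + s⁻¹ • ν + (1 : ℝ) • (F *ᵥ ξ)) + (1 - s) • μ₀ := by
    ext i
    simp only [Pi.add_apply, Pi.smul_apply, smul_eq_mul]
    field_simp
    ring
  simp only [rejRegion, Set.mem_ofPred_eq, this, stat_dilation hX κ hs.ne' _ hμ₀]

/-- The statistic is unbounded: over a sample in `statSet` a shift by Xβ makes a positive definite
form arbitrarily large. By continuity it exceeds C on an open set, which has positive mass under the
identity covariance Λ(0). -/
lemma size_rejRegion_pos (hX : X.rank = k) (hR : R.rank = q) (hq : 1 ≤ q)
    (ha : IsAdmissible n k a₁ a₂) (κ : TestKind) {C : ℝ} (hC : 0 < C)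
    {𝔠 : Set (Matrix (Fin n) (Fin n) ℝ)} (h𝔠 : arModel n ⊆ 𝔠) :
    0 < size X R r 𝔠 (rejRegion κ X R r a₁ a₂ C) := by
  obtain ⟨μ₀, hμ₀⟩ := nullMeans_nonempty (X := X) (r := r) hR
  obtain ⟨y, hy⟩ := statSet_nonempty (X := X) ha
  obtain ⟨δ, hδ⟩ := exists_mulVec_ne_zero hR hq
  have hkn := ha.2.2.2.2
  have hyN := notMem_excSet_of_mem_statSet hX hR hkn κ hy
  have hQ := weight_quad_pos hX hR hkn κ hy hδ
  set Q := (R *ᵥ δ) ⬝ᵥ (weight κ X R a₁ a₂ y *ᵥ (R *ᵥ δ)) with hQdef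
  obtain ⟨s, hs⟩ : ∃ s : ℝ, C < s ^ 2 * Q := by
    -- With x = C/Q > 0 one has (x + 1)² > x.
    refine ⟨C / Q + 1, ?_⟩
    have h1 : 0 < C / Q := by positivity
    have h2 : C = (C / Q) * Q := by field_simp
    nlinarith [mul_pos h1 hQ, mul_pos (mul_pos h1 h1) hQ]
  obtain ⟨β, hβ⟩ := mulVec_surjective_of_rank hR (r - R *ᵥ coefEst κ X a₁ a₂ y + s • (R *ᵥ δ))
  have hstat : C < stat κ X R r a₁ a₂ ((1 : ℝ) • y + X *ᵥ β) := by
    rw [stat_smul_add hX κ r one_ne_zero β hyN]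
    have : R *ᵥ coefEst κ X a₁ a₂ y + (1 : ℝ)⁻¹ • (R *ᵥ β - r) = s • (R *ᵥ δ) := by
      rw [hβ, inv_one, one_smul]; abel
    rw [this, Matrix.mulVec_smul, smul_dotProduct, dotProduct_smul, smul_eq_mul, smul_eq_mul,
      ← mul_assoc, ← sq]
    exact hs
  have hc := continuousAt_stat ha κ r (notMem_excSet_smul_add hX κ one_ne_zero β hyN)
  have hmem : (1 : Matrix (Fin n) (Fin n) ℝ) * (1 : Matrix (Fin n) (Fin n) ℝ)ᵀ ∈ 𝔠 := by
    refine h𝔠 ⟨0, by norm_num, by norm_num, ?_⟩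
    rw [arMatrix_zero, Matrix.transpose_one, Matrix.mul_one]
  have hpos : 0 < gaussianLaw μ₀ ((1 : ℝ) ^ 2 • ((1 : Matrix (Fin n) (Fin n) ℝ) *
      (1 : Matrix (Fin n) (Fin n) ℝ)ᵀ)) (rejRegion κ X R r a₁ a₂ C) := by
    rw [gaussianLaw_apply _ _ _ (measurableSet_rejRegion ha κ r hC)]
    refine Measure.measure_pos_of_mem_nhds (stdNormal n) (x := (1 : ℝ) • y + X *ᵥ β - μ₀) ?_
    have hcont : Continuous fun ξ : Fin n → ℝ =>
        μ₀ + (1 : ℝ) • ((1 : Matrix (Fin n) (Fin n) ℝ) *ᵥ ξ) := by fun_prop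
    have hval : μ₀ + (1 : ℝ) • ((1 : Matrix (Fin n) (Fin n) ℝ) *ᵥ ((1 : ℝ) • y + X *ᵥ β - μ₀)) =
        (1 : ℝ) • y + X *ᵥ β := by
      rw [Matrix.one_mulVec]; simp
    have h1 := hcont.tendsto ((1 : ℝ) • y + X *ᵥ β - μ₀)
    rw [hval] at h1
    filter_upwards [(hc.tendsto.comp h1).eventually_const_lt hstat] with ξ hξ
    exact le_of_lt hξ
  refine hpos.trans_le ?_
  unfold size
  exact le_iSup₂_of_le μ₀ hμ₀ (le_iSup₂_of_le 1 one_pos (le_iSup₂_of_le _ hmem le_rfl))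

end Tests

/-! ### Size, power and bias when e is not exceptional. -/

section Tests

variable {n k q : ℕ} {X : Matrix (Fin n) (Fin k) ℝ} {R : Matrix (Fin q) (Fin k) ℝ}
  {a₁ a₂ : ℕ} {r : Fin q → ℝ} {κ : TestKind} {e : Fin n → ℝ} {C σ : ℝ}
  {𝔠 : Set (Matrix (Fin n) (Fin n) ℝ)} {W : Set (Fin n → ℝ)} {μ₀ : Fin n → ℝ}

lemma arFactor_nullSeq_mem (he : IsUnitRootDir e) (h𝔠 : arModel n ⊆ 𝔠) (m : ℕ) :
    arFactor e (nullSeq m) * (arFactor e (nullSeq m))ᵀ ∈ 𝔠 :=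
  h𝔠 (exists_arFactor_mul_transpose he (nullSeq_pos m))

/-- If the value of the test statistic at the unit root direction exceeds the critical value, the
rejection probabilities under the null hypothesis come arbitrarily close to one. -/
theorem iSup_gaussianLaw_eq_one (hX : X.rank = k) (ha : IsAdmissible n k a₁ a₂)
    (hu : IsUnitRootDir e) (h𝔠 : arModel n ⊆ 𝔠) (he : e ∉ excSet κ X R a₁ a₂) (hC : 0 < C)
    (hμ₀ : μ₀ ∈ nullMeans X R r) (hσ : 0 < σ) (hT : C < stat κ X R r a₁ a₂ (e + μ₀)) :
    (⨆ S ∈ 𝔠, gaussianLaw μ₀ (σ ^ 2 • S) (rejRegion κ X R r a₁ a₂ C)) = 1 := by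
  refine le_antisymm (iSup₂_le fun S _ => prob_le_one) ?_
  refine le_of_tendsto' (tendsto_gaussianLaw_one hX ha he hC hμ₀ tendsto_const_nhds hσ hT)
    fun m => le_iSup₂_of_le _ (arFactor_nullSeq_mem hu h𝔠 m) le_rfl

theorem size_eq_one (hX : X.rank = k) (ha : IsAdmissible n k a₁ a₂)
    (hu : IsUnitRootDir e) (h𝔠 : arModel n ⊆ 𝔠) (he : e ∉ excSet κ X R a₁ a₂) (hC : 0 < C)
    (hμ₀ : μ₀ ∈ nullMeans X R r) (hT : C < stat κ X R r a₁ a₂ (e + μ₀)) :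
    size X R r 𝔠 (rejRegion κ X R r a₁ a₂ C) = 1 := by
  refine le_antisymm (iSup₂_le fun _ _ => iSup₂_le fun _ _ => iSup₂_le fun _ _ => prob_le_one) ?_
  rw [← iSup_gaussianLaw_eq_one hX ha hu h𝔠 he hC hμ₀ one_pos hT]
  exact le_iSup₂_of_le μ₀ hμ₀ (le_iSup₂_of_le 1 one_pos le_rfl)

theorem iInf_gaussianLaw_eq_zero (hX : X.rank = k) (ha : IsAdmissible n k a₁ a₂)
    (hu : IsUnitRootDir e) (h𝔠 : arModel n ⊆ 𝔠) (he : e ∉ excSet κ X R a₁ a₂) (hC : 0 < C)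
    (hμ₀ : μ₀ ∈ nullMeans X R r) (hσ : 0 < σ) (hT : stat κ X R r a₁ a₂ (e + μ₀) < C) :
    (⨅ S ∈ 𝔠, gaussianLaw μ₀ (σ ^ 2 • S) (rejRegion κ X R r a₁ a₂ C)) = 0 := by
  refine le_antisymm ?_ zero_le
  exact ge_of_tendsto' (tendsto_gaussianLaw_zero hX ha he hC hμ₀ tendsto_const_nhds hσ hT)
    fun m => iInf₂_le_of_le _ (arFactor_nullSeq_mem hu h𝔠 m) le_rfl

theorem iInf_altMeans_gaussianLaw_eq_zero (hX : X.rank = k) (hR : R.rank = q) (hq : 1 ≤ q)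
    (ha : IsAdmissible n k a₁ a₂)
    (hu : IsUnitRootDir e) (h𝔠 : arModel n ⊆ 𝔠) (he : e ∉ excSet κ X R a₁ a₂) (hC : 0 < C)
    (hμ₀ : μ₀ ∈ nullMeans X R r) (hσ : 0 < σ) (hT : stat κ X R r a₁ a₂ (e + μ₀) < C) :
    (⨅ μ₁ ∈ altMeans X R r, ⨅ S ∈ 𝔠,
      gaussianLaw μ₁ (σ ^ 2 • S) (rejRegion κ X R r a₁ a₂ C)) = 0 := by
  obtain ⟨δ, hδ⟩ := exists_mulVec_ne_zero hR hq
  have hlim : Tendsto (fun m => μ₀ + nullSeq m • (X *ᵥ δ)) atTop (𝓝 μ₀) := by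
    simpa using (tendsto_nullSeq.smul_const (X *ᵥ δ)).const_add μ₀
  refine le_antisymm ?_ zero_le
  exact ge_of_tendsto' (tendsto_gaussianLaw_zero hX ha he hC hμ₀ hlim hσ hT)
    fun m => iInf₂_le_of_le _ (add_smul_mem_altMeans hX hμ₀ hδ (nullSeq_pos m).ne')
      (iInf₂_le_of_le _ (arFactor_nullSeq_mem hu h𝔠 m) le_rfl)

theorem iInf_sigma_gaussianLaw_eq_zero (hX : X.rank = k) (ha : IsAdmissible n k a₁ a₂)
    (hu : IsUnitRootDir e) (h𝔠 : arModel n ⊆ 𝔠) (he : e ∉ excSet κ X R a₁ a₂) (hC : 0 < C)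
    (hμ₀ : μ₀ ∈ nullMeans X R r) (hT : stat κ X R r a₁ a₂ (e + μ₀) < C) (μ₁ : Fin n → ℝ) :
    (⨅ (σ : ℝ) (_ : 0 < σ), ⨅ S ∈ 𝔠,
      gaussianLaw μ₁ (σ ^ 2 • S) (rejRegion κ X R r a₁ a₂ C)) = 0 := by
  have hlim : Tendsto (fun m => μ₀ + nullSeq m • (μ₁ - μ₀)) atTop (𝓝 μ₀) := by
    simpa using (tendsto_nullSeq.smul_const (μ₁ - μ₀)).const_add μ₀
  refine le_antisymm ?_ zero_le
  refine ge_of_tendsto' (tendsto_gaussianLaw_zero hX ha he hC hμ₀ hlim one_pos hT) fun m => ?_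
  -- Standard deviation 1/`nullSeq m` at μ₁ is equivalent to standard deviation 1 at a mean that
  -- tends to μ₀.
  refine iInf₂_le_of_le (nullSeq m)⁻¹ (inv_pos.2 (nullSeq_pos m))
    (iInf₂_le_of_le _ (arFactor_nullSeq_mem hu h𝔠 m) (le_of_eq ?_))
  have := gaussianLaw_rejRegion_dilation (R := R) hX ha κ hC hμ₀ (μ₁ - μ₀)
    (inv_pos.2 (nullSeq_pos m)) (arFactor e (nullSeq m))
  rwa [add_sub_cancel, inv_inv] at this

theorem infPower_eq_zero (hX : X.rank = k) (hR : R.rank = q) (hq : 1 ≤ q)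
    (ha : IsAdmissible n k a₁ a₂)
    (hu : IsUnitRootDir e) (h𝔠 : arModel n ⊆ 𝔠) (he : e ∉ excSet κ X R a₁ a₂) (hC : 0 < C)
    (hμ₀ : μ₀ ∈ nullMeans X R r) (hT : stat κ X R r a₁ a₂ (e + μ₀) < C) :
    infPower X R r 𝔠 (rejRegion κ X R r a₁ a₂ C) = 0 := by
  obtain ⟨δ, hδ⟩ := exists_mulVec_ne_zero hR hq
  refine le_antisymm ?_ zero_le
  exact iInf₂_le_of_le _ (add_smul_mem_altMeans hX hμ₀ hδ one_ne_zero)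
    (iInf_sigma_gaussianLaw_eq_zero hX ha hu h𝔠 he hC hμ₀ hT _).le

lemma isBiased_of_infPower_lt_size (h : infPower X R r 𝔠 W < size X R r 𝔠 W) :
    IsBiased X R r 𝔠 W := by
  obtain ⟨μ₁, h⟩ := iInf_lt_iff.1 h
  obtain ⟨hμ₁, h⟩ := iInf_lt_iff.1 h
  obtain ⟨σ, h⟩ := iInf_lt_iff.1 h
  obtain ⟨hσ, h⟩ := iInf_lt_iff.1 h
  obtain ⟨S, h⟩ := iInf_lt_iff.1 h
  obtain ⟨hS, h⟩ := iInf_lt_iff.1 h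
  exact ⟨μ₁, hμ₁, σ, hσ, S, hS, h⟩

theorem isBiased_rejRegion (hX : X.rank = k) (hR : R.rank = q) (hq : 1 ≤ q)
    (ha : IsAdmissible n k a₁ a₂)
    (hu : IsUnitRootDir e) (h𝔠 : arModel n ⊆ 𝔠) (he : e ∉ excSet κ X R a₁ a₂) (hC : 0 < C)
    (hμ₀ : μ₀ ∈ nullMeans X R r) (hT : stat κ X R r a₁ a₂ (e + μ₀) < C) :
    IsBiased X R r 𝔠 (rejRegion κ X R r a₁ a₂ C) := by
  refine isBiased_of_infPower_lt_size ?_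
  rw [infPower_eq_zero hX hR hq ha hu h𝔠 he hC hμ₀ hT]
  exact size_rejRegion_pos hX hR hq ha κ hC h𝔠

/-- The value of the test statistic at `e + μ` is the same for all null means `μ`. -/
lemma stat_add_null_eq (hX : X.rank = k) (he : e ∉ excSet κ X R a₁ a₂) {μ μ' : Fin n → ℝ}
    (hμ : μ ∈ nullMeans X R r) (hμ' : μ' ∈ nullMeans X R r) :
    stat κ X R r a₁ a₂ (e + μ) = stat κ X R r a₁ a₂ (e + μ') := by
  have h1 := stat_smul_add_null hX κ one_ne_zero he hμ
  have h2 := stat_smul_add_null hX κ one_ne_zero he hμ'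
  rw [one_smul] at h1 h2
  rw [h1, h2]

/-! ### The unit root direction in the column space of the design matrix -/

/-- The innovations whose limiting path deviation makes the test reject when the signal in the
direction `X δ` becomes dominant. -/
def dominantSet (κ : TestKind) (X : Matrix (Fin n) (Fin k) ℝ) (R : Matrix (Fin q) (Fin k) ℝ)
    (a₁ a₂ : ℕ) (e : Fin n → ℝ) (δ : Fin k → ℝ) : Set (Fin n → ℝ) :=
  {ξ | pathDev e 0 ξ ∉ excSet κ X R a₁ a₂ ∧
    0 < (R *ᵥ δ) ⬝ᵥ (weight κ X R a₁ a₂ (pathDev e 0 ξ) *ᵥ (R *ᵥ δ))}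

lemma measurableSet_dominantSet (ha : IsAdmissible n k a₁ a₂) (δ : Fin k → ℝ) :
    MeasurableSet (dominantSet κ X R a₁ a₂ e δ) := by
  have h1 : IsOpen ((excSet κ X R a₁ a₂)ᶜ ∩
      (fun y => (R *ᵥ δ) ⬝ᵥ (weight κ X R a₁ a₂ y *ᵥ (R *ᵥ δ))) ⁻¹' Set.Ioi 0) := by
    refine ContinuousOn.isOpen_inter_preimage (fun y hy => ?_) (isOpen_compl_excSet ha κ) isOpen_Ioi
    exact (continuousAt_dotProduct continuousAt_const (continuousAt_mulVec
      (continuousAt_weight ha κ hy) continuousAt_const)).continuousWithinAt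
  exact (h1.preimage (continuous_pathDev_right e 0)).measurableSet

/-- The unwanted multiple of e in `exists_pathDev_zero_eq` lies in the column space and leaves the
residuals unchanged. -/
lemma exists_pathDev_mem_statSet (hX : X.rank = k) (ha : IsAdmissible n k a₁ a₂)
    (hu : IsUnitRootDir e) {δ : Fin k → ℝ} (hδ : e = X *ᵥ δ) :
    ∃ ξ, pathDev e 0 ξ ∈ statSet X a₁ a₂ := by
  obtain ⟨y, hy⟩ := statSet_nonempty (X := X) ha
  obtain ⟨ξ, a, hξ⟩ := exists_pathDev_zero_eq hu.1 y
  refine ⟨ξ, ?_⟩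
  have h : y + a • e = (1 : ℝ) • y + X *ᵥ (a • δ) := by
    rw [hδ, one_smul, Matrix.mulVec_smul]
  change |lagSum X (pathDev e 0 ξ)| < sqSum X a₁ a₂ (pathDev e 0 ξ)
  rw [hξ, h, lagSum_smul_add hX, sqSum_smul_add hX, one_pow, one_mul, one_mul]
  exact hy

/-- The test statistic along a path with an additional signal in the direction `e = X δ`. -/
lemma stat_add_arFactor_mulVec (hX : X.rank = k) {δ β : Fin k → ℝ} (hβ : R *ᵥ β = r)
    (hσ : 0 < σ) {t : ℝ} (ht : 0 < t) (γ : ℝ) {ξ : Fin n → ℝ}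
    (hξ : pathDev (X *ᵥ δ) t ξ ∉ excSet κ X R a₁ a₂) :
    stat κ X R r a₁ a₂ (X *ᵥ β + γ • (X *ᵥ δ) + σ • (arFactor (X *ᵥ δ) t *ᵥ ξ)) =
      (R *ᵥ coefEst κ X a₁ a₂ (pathDev (X *ᵥ δ) t ξ) +
          ((σ * arScale t)⁻¹ * (γ + σ * firstCoord ξ)) • (R *ᵥ δ)) ⬝ᵥ
        (weight κ X R a₁ a₂ (pathDev (X *ᵥ δ) t ξ) *ᵥ
          (R *ᵥ coefEst κ X a₁ a₂ (pathDev (X *ᵥ δ) t ξ) +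
            ((σ * arScale t)⁻¹ * (γ + σ * firstCoord ξ)) • (R *ᵥ δ))) := by
  have hs : σ * arScale t ≠ 0 := (mul_pos hσ (arScale_pos ht)).ne'
  have h1 : X *ᵥ β + γ • (X *ᵥ δ) + σ • (arFactor (X *ᵥ δ) t *ᵥ ξ) =
      (σ * arScale t) • pathDev (X *ᵥ δ) t ξ + X *ᵥ (β + (γ + σ * firstCoord ξ) • δ) := by
    rw [arFactor_mulVec, Matrix.mulVec_add, Matrix.mulVec_smul]
    ext i
    simp only [Pi.add_apply, Pi.smul_apply, smul_eq_mul]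
    ring
  have h2 : R *ᵥ (β + (γ + σ * firstCoord ξ) • δ) - r =
      (γ + σ * firstCoord ξ) • (R *ᵥ δ) := by
    rw [Matrix.mulVec_add, Matrix.mulVec_smul, hβ, add_sub_cancel_left]
  rw [h1, stat_smul_add hX κ r hs _ hξ, h2, smul_smul]

/-- After division by g² the vector becomes c + b/g, which tends to c. No definiteness of the
matrices is needed. -/
lemma tendsto_quad_smul {b : ℕ → Fin q → ℝ} {b₀ c : Fin q → ℝ}
    {A : ℕ → Matrix (Fin q) (Fin q) ℝ} {A₀ : Matrix (Fin q) (Fin q) ℝ} {g : ℕ → ℝ}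
    (hb : Tendsto b atTop (𝓝 b₀)) (hA : Tendsto A atTop (𝓝 A₀))
    (hg : Tendsto (fun m => |g m|) atTop atTop) :
    Tendsto (fun m => (g m ^ 2)⁻¹ * ((b m + g m • c) ⬝ᵥ (A m *ᵥ (b m + g m • c)))) atTop
      (𝓝 (c ⬝ᵥ (A₀ *ᵥ c))) := by
  have hginv : Tendsto (fun m => (g m)⁻¹) atTop (𝓝 0) := by
    rw [tendsto_zero_iff_abs_tendsto_zero]
    refine hg.inv_tendsto_atTop.congr fun m => ?_
    simp [abs_inv]
  have h1 : Tendsto (fun m => (g m)⁻¹ • b m + c) atTop (𝓝 c) := by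
    simpa using (hginv.smul hb).add_const c
  have hq : Continuous fun z : (Fin q → ℝ) × Matrix (Fin q) (Fin q) ℝ =>
      z.1 ⬝ᵥ (z.2 *ᵥ z.1) :=
    Continuous.dotProduct continuous_fst (continuous_snd.matrix_mulVec continuous_fst)
  refine ((hq.tendsto (c, A₀)).comp (h1.prodMk_nhds hA)).congr' ?_
  filter_upwards [hg.eventually_gt_atTop 0] with m hm
  have hm0 : g m ≠ 0 := abs_pos.1 hm
  have h2 : b m + g m • c = g m • ((g m)⁻¹ • b m + c) := by
    rw [smul_add, smul_smul, mul_inv_cancel₀ hm0, one_smul]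
  simp only [Function.comp_apply]
  rw [h2, Matrix.mulVec_smul, smul_dotProduct, dotProduct_smul, smul_eq_mul, smul_eq_mul]
  field_simp

/-- The rejection probabilities along a sequence of signals in the direction `e = X δ`, as the
autoregressive parameter tends to the unit root. -/
theorem tendsto_gaussianLaw_dominantSet (hX : X.rank = k) (hR : R.rank = q)
    (ha : IsAdmissible n k a₁ a₂) (hu : IsUnitRootDir e) {δ : Fin k → ℝ} (hδ : e = X *ᵥ δ)
    (hRδ : R *ᵥ δ ≠ 0) (hC : 0 < C) (hμ₀ : μ₀ ∈ nullMeans X R r) (hσ : 0 < σ) {γ : ℕ → ℝ}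
    (hγ : ∀ z : ℝ, z ≠ 0 → ∃ η > 0, ∀ᶠ m in atTop, η ≤ |γ m + z|) :
    Tendsto (fun m => gaussianLaw (μ₀ + γ m • e)
      (σ ^ 2 • (arFactor e (nullSeq m) * (arFactor e (nullSeq m))ᵀ))
        (rejRegion κ X R r a₁ a₂ C)) atTop (𝓝 (stdNormal n (dominantSet κ X R a₁ a₂ e δ))) := by
  have hkn := ha.2.2.2.2
  have hne := exists_pathDev_mem_statSet hX ha hu hδ
  refine tendsto_gaussianLaw (measurableSet_rejRegion ha κ r hC) (measurableSet_dominantSet ha δ) ?_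
  filter_upwards [ae_firstCoord_ne_zero (n := n) (by omega),
    ae_notMem_excSet hX hR hkn κ (genRat_pathDev e 0) (continuous_pathDev_right e 0) hne,
    ae_weight_quad_ne_zero hX hR hkn κ (genRat_pathDev e 0) (continuous_pathDev_right e 0) hne hRδ]
    with ξ h0 hN hQ
  obtain ⟨β, rfl, hβ⟩ := hμ₀
  have hw : Tendsto (fun m => pathDev e (nullSeq m) ξ) atTop (𝓝 (pathDev e 0 ξ)) :=
    ((continuous_pathDev_left e ξ).tendsto 0).comp tendsto_nullSeq
  set g : ℕ → ℝ := fun m => (σ * arScale (nullSeq m))⁻¹ * (γ m + σ * firstCoord ξ) with hg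
  have hgt : Tendsto (fun m => |g m|) atTop atTop := by
    -- With z = σ ξ₁ ≠ 0 the numerator of g stays away from zero, while its denominator σ c(t) tends
    -- to 0.
    obtain ⟨η, hη, hev⟩ := hγ _ (mul_ne_zero hσ.ne' h0)
    have h1 : Tendsto (fun m => σ * arScale (nullSeq m)) atTop (𝓝[>] 0) := by
      refine tendsto_nhdsWithin_iff.2 ⟨?_, Eventually.of_forall fun m =>
        mul_pos hσ (arScale_pos (nullSeq_pos m))⟩
      have := ((continuous_arScale.tendsto 0).comp tendsto_nullSeq).const_mul σ
      rwa [arScale_zero, mul_zero] at this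
    refine tendsto_atTop_mono' _ ?_ (h1.inv_tendsto_nhdsGT_zero.atTop_mul_const hη)
    filter_upwards [hev] with m hm
    have hp := inv_pos.2 (mul_pos hσ (arScale_pos (nullSeq_pos m)))
    rw [hg]
    simp only [abs_mul, abs_of_pos hp, Pi.inv_apply]
    exact mul_le_mul_of_nonneg_left hm hp.le
  have hlim := tendsto_quad_smul (c := R *ᵥ δ)
    ((continuousAt_mulVec (continuousAt_const (y := R))
      (continuousAt_coefEst ha κ hN)).tendsto.comp hw)
    ((continuousAt_weight ha κ hN).tendsto.comp hw) hgt
  have hNev := hw.eventually ((isOpen_compl_excSet ha κ).mem_nhds hN)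
  have hg2 : Tendsto (fun m => g m ^ 2) atTop atTop := by
    simpa only [sq_abs, Function.comp_def] using (tendsto_pow_atTop two_ne_zero).comp hgt
  have hstat : ∀ᶠ m in atTop, stat κ X R r a₁ a₂
      (X *ᵥ β + γ m • e + σ • (arFactor e (nullSeq m) *ᵥ ξ)) = g m ^ 2 * ((g m ^ 2)⁻¹ *
        ((R *ᵥ coefEst κ X a₁ a₂ (pathDev e (nullSeq m) ξ) + g m • (R *ᵥ δ)) ⬝ᵥ
          (weight κ X R a₁ a₂ (pathDev e (nullSeq m) ξ) *ᵥ
            (R *ᵥ coefEst κ X a₁ a₂ (pathDev e (nullSeq m) ξ) + g m • (R *ᵥ δ))))) := by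
    filter_upwards [hNev, hg2.eventually_gt_atTop 0] with m hm hgm
    rw [mul_inv_cancel_left₀ hgm.ne']
    subst hδ
    exact stat_add_arFactor_mulVec hX hβ hσ (nullSeq_pos m) (γ m) hm
  -- A negative limit of T/g² makes T eventually negative, hence below C; a positive limit sends T
  -- to infinity.
  rcases lt_or_gt_of_ne hQ with hneg | hpos
  · filter_upwards [hstat, hlim.eventually_lt_const hneg, hg2.eventually_gt_atTop 0]
      with m h1 h2 h3
    have h5 := h1.trans_lt ((mul_neg_of_pos_of_neg h3 h2).trans hC)
    exact iff_of_false (fun h => not_lt_of_ge h h5) fun h => not_lt_of_gt hneg h.2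
  · have h4 := hg2.atTop_mul_pos hpos hlim
    filter_upwards [hstat, h4.eventually_ge_atTop C] with m h1 h2
    refine iff_of_true ?_ ⟨hN, hpos⟩
    change C ≤ stat κ X R r a₁ a₂ _
    rw [h1]
    exact h2

lemma stdNormal_dominantSet_eq_one (hX : X.rank = k) (hR : R.rank = q)
    (ha : IsAdmissible n k a₁ a₂) (hu : IsUnitRootDir e) {δ : Fin k → ℝ} (hδ : e = X *ᵥ δ)
    (hRδ : R *ᵥ δ ≠ 0) (h : ∀ y, y ∉ N0 X a₁ a₂ → rhoHat X a₁ a₂ y = rhoYW X y) :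
    stdNormal n (dominantSet κ X R a₁ a₂ e δ) = 1 := by
  have hkn := ha.2.2.2.2
  rw [← measure_univ (μ := stdNormal n)]
  refine measure_congr (eventuallyEq_univ.2 ?_)
  filter_upwards [ae_notMem_excSet hX hR hkn κ (genRat_pathDev e 0) (continuous_pathDev_right e 0)
    (exists_pathDev_mem_statSet hX ha hu hδ)] with ξ hN
  have hN0 : pathDev e 0 ξ ∉ N0 X a₁ a₂ := by
    cases κ
    · exact fun h => (notMem_excSet_fgls.1 hN).1.1 (N0_subset_N1 ha h)
    · exact (notMem_excSet_ols.1 hN).1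
  exact ⟨hN, weight_quad_pos hX hR hkn κ (mem_statSet_of_rhoHat_eq_rhoYW hN0 (h _ hN0)) hRδ⟩

lemma stdNormal_dominantSet_le_iSup (hX : X.rank = k) (hR : R.rank = q)
    (ha : IsAdmissible n k a₁ a₂) (hu : IsUnitRootDir e) {δ : Fin k → ℝ} (hδ : e = X *ᵥ δ)
    (hRδ : R *ᵥ δ ≠ 0) (h𝔠 : arModel n ⊆ 𝔠) (hC : 0 < C) (hμ₀ : μ₀ ∈ nullMeans X R r)
    (hσ : 0 < σ) :
    stdNormal n (dominantSet κ X R a₁ a₂ e δ) ≤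
      ⨆ S ∈ 𝔠, gaussianLaw μ₀ (σ ^ 2 • S) (rejRegion κ X R r a₁ a₂ C) := by
  -- Under the null γ = 0, and the signal is the random multiple σ ξ₁ of e itself.
  have h := tendsto_gaussianLaw_dominantSet (κ := κ) (γ := fun _ => 0) hX hR ha hu hδ hRδ hC hμ₀ hσ
    fun z hz => ⟨|z|, abs_pos.2 hz, by simp⟩
  simp only [zero_smul, add_zero] at h
  exact le_of_tendsto' h fun m => le_iSup₂_of_le _ (arFactor_nullSeq_mem hu h𝔠 m) le_rfl

lemma iInf_le_stdNormal_dominantSet (hX : X.rank = k) (hR : R.rank = q)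
    (ha : IsAdmissible n k a₁ a₂) (hu : IsUnitRootDir e) {δ : Fin k → ℝ} (hδ : e = X *ᵥ δ)
    (hRδ : R *ᵥ δ ≠ 0) (h𝔠 : arModel n ⊆ 𝔠) (hC : 0 < C) (hμ₀ : μ₀ ∈ nullMeans X R r)
    (hσ : 0 < σ) (M : ℝ) :
    (⨅ (γ : ℝ) (_ : M ≤ |γ|), ⨅ S ∈ 𝔠, gaussianLaw (μ₀ + γ • e) (σ ^ 2 • S)
      (rejRegion κ X R r a₁ a₂ C)) ≤ stdNormal n (dominantSet κ X R a₁ a₂ e δ) := by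
  have hM : Tendsto (fun m : ℕ => M + m) atTop atTop :=
    tendsto_atTop_add_const_left _ _ tendsto_natCast_atTop_atTop
  -- A diverging γ with |γ| ≥ M has the same limit as γ = 0, which bounds the infimum for every M.
  have h := tendsto_gaussianLaw_dominantSet (κ := κ) (γ := fun m => M + m) hX hR ha hu hδ hRδ hC
    hμ₀ hσ fun z _ => ⟨1, one_pos, by
      filter_upwards [hM.eventually_ge_atTop (1 - z)] with m hm
      exact le_trans (by linarith) (le_abs_self _)⟩
  exact ge_of_tendsto' h fun m => iInf₂_le_of_le (M + m)
    (le_trans (by have : (0 : ℝ) ≤ m := m.cast_nonneg; linarith) (le_abs_self _))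
    (iInf₂_le_of_le _ (arFactor_nullSeq_mem hu h𝔠 m) le_rfl)

end Tests

end AutocorrTest

end

theorem theorem3p9
    {n k q : ℕ} (hk : 1 ≤ k) (hkn : k < n) (hq : 1 ≤ q)
    (X : Matrix (Fin n) (Fin k) ℝ) (hX : X.rank = k)
    (R : Matrix (Fin q) (Fin k) ℝ) (hR : R.rank = q)
    (a₁ a₂ : ℕ) (ha₁ : a₁ = 1 ∨ a₁ = 2) (ha₂ : a₂ = n - 1 ∨ a₂ = n) (hka : k + a₁ ≤ a₂)
    (κ : AutocorrTest.TestKind)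
    (e : Fin n → ℝ) (he : e = AutocorrTest.ePlus n ∨ e = AutocorrTest.eMinus n) :
    -- Parts 1 and 2
    (∀ (r : Fin q → ℝ) (𝔠 : Set (Matrix (Fin n) (Fin n) ℝ)) (C : ℝ),
      (∀ S ∈ 𝔠, S.PosDef) → AutocorrTest.arModel n ⊆ 𝔠 → 0 < C →
      e ∉ AutocorrTest.excSet κ X R a₁ a₂ →
        -- Part 1
        (((∃ μ ∈ AutocorrTest.nullMeans X R r, C < AutocorrTest.stat κ X R r a₁ a₂ (e + μ)) ↔
            ∀ μ ∈ AutocorrTest.nullMeans X R r, C < AutocorrTest.stat κ X R r a₁ a₂ (e + μ)) ∧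
          ((∃ μ ∈ AutocorrTest.nullMeans X R r, C < AutocorrTest.stat κ X R r a₁ a₂ (e + μ)) →
            (∀ μ₀ ∈ AutocorrTest.nullMeans X R r, ∀ σ : ℝ, 0 < σ →
              (⨆ S ∈ 𝔠, AutocorrTest.gaussianLaw μ₀ (σ ^ 2 • S)
                (AutocorrTest.rejRegion κ X R r a₁ a₂ C)) = 1) ∧
            AutocorrTest.size X R r 𝔠 (AutocorrTest.rejRegion κ X R r a₁ a₂ C) = 1)) ∧
        -- Part 2
        (((∃ μ ∈ AutocorrTest.nullMeans X R r, AutocorrTest.stat κ X R r a₁ a₂ (e + μ) < C) ↔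
            ∀ μ ∈ AutocorrTest.nullMeans X R r, AutocorrTest.stat κ X R r a₁ a₂ (e + μ) < C) ∧
          ((∃ μ ∈ AutocorrTest.nullMeans X R r, AutocorrTest.stat κ X R r a₁ a₂ (e + μ) < C) →
            (∀ μ₀ ∈ AutocorrTest.nullMeans X R r, ∀ σ : ℝ, 0 < σ →
              (⨅ S ∈ 𝔠, AutocorrTest.gaussianLaw μ₀ (σ ^ 2 • S)
                (AutocorrTest.rejRegion κ X R r a₁ a₂ C)) = 0) ∧
            (∀ σ : ℝ, 0 < σ →
              (⨅ μ₁ ∈ AutocorrTest.altMeans X R r, ⨅ S ∈ 𝔠,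
                AutocorrTest.gaussianLaw μ₁ (σ ^ 2 • S)
                  (AutocorrTest.rejRegion κ X R r a₁ a₂ C)) = 0) ∧
            AutocorrTest.IsBiased X R r 𝔠 (AutocorrTest.rejRegion κ X R r a₁ a₂ C) ∧
            (∀ μ₁ ∈ AutocorrTest.altMeans X R r,
              (⨅ (σ : ℝ) (_ : 0 < σ), ⨅ S ∈ 𝔠, AutocorrTest.gaussianLaw μ₁ (σ ^ 2 • S)
                (AutocorrTest.rejRegion κ X R r a₁ a₂ C)) = 0) ∧
            AutocorrTest.infPower X R r 𝔠 (AutocorrTest.rejRegion κ X R r a₁ a₂ C) = 0))) ∧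
    -- Part 3: the constant is chosen before `r`, the covariance model, `C`, `μ₀`, `σ` and `M`
    (e ∈ AutocorrTest.meanSpace X → R *ᵥ AutocorrTest.betaHat X e ≠ 0 →
      ∃ K : ℝ≥0,
        ((∀ y, y ∉ AutocorrTest.N0 X a₁ a₂ →
            AutocorrTest.rhoHat X a₁ a₂ y = AutocorrTest.rhoYW X y) → K = 1) ∧
        ∀ (r : Fin q → ℝ) (𝔠 : Set (Matrix (Fin n) (Fin n) ℝ)) (C : ℝ),
          (∀ S ∈ 𝔠, S.PosDef) → AutocorrTest.arModel n ⊆ 𝔠 → 0 < C →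
          ∀ μ₀ ∈ AutocorrTest.nullMeans X R r,
            (∀ γ : ℝ, γ ≠ 0 → μ₀ + γ • e ∈ AutocorrTest.altMeans X R r) ∧
            ∀ σ : ℝ, 0 < σ →
              (∀ M : ℝ, 0 ≤ M →
                (⨅ (γ : ℝ) (_ : M ≤ |γ|), ⨅ S ∈ 𝔠,
                  AutocorrTest.gaussianLaw (μ₀ + γ • e) (σ ^ 2 • S)
                    (AutocorrTest.rejRegion κ X R r a₁ a₂ C)) ≤ (K : ℝ≥0∞)) ∧
              (K : ℝ≥0∞) ≤ (⨆ S ∈ 𝔠, AutocorrTest.gaussianLaw μ₀ (σ ^ 2 • S)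
                (AutocorrTest.rejRegion κ X R r a₁ a₂ C)) ∧
              ((∀ y, y ∉ AutocorrTest.N0 X a₁ a₂ →
                  AutocorrTest.rhoHat X a₁ a₂ y = AutocorrTest.rhoYW X y) →
                (⨆ S ∈ 𝔠, AutocorrTest.gaussianLaw μ₀ (σ ^ 2 • S)
                  (AutocorrTest.rejRegion κ X R r a₁ a₂ C)) = 1)) := by
  have ha : AutocorrTest.IsAdmissible n k a₁ a₂ := ⟨ha₁, ha₂, hka, hk, hkn⟩
  have hu : AutocorrTest.IsUnitRootDir e := by
    rcases he with rfl | rfl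
    · exact AutocorrTest.isUnitRootDir_ePlus n
    · exact AutocorrTest.isUnitRootDir_eMinus n
  refine ⟨fun r 𝔠 C _ h𝔠 hC heN => ⟨⟨⟨?_, ?_⟩, ?_⟩, ⟨?_, ?_⟩, ?_⟩, ?_⟩
  · rintro ⟨μ, hμ, h⟩ μ' hμ'
    rwa [← AutocorrTest.stat_add_null_eq hX heN hμ hμ']
  · intro h
    obtain ⟨μ, hμ⟩ := AutocorrTest.nullMeans_nonempty (X := X) (r := r) hR
    exact ⟨μ, hμ, h μ hμ⟩
  · rintro ⟨μ, hμ, h⟩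
    refine ⟨fun μ₀ hμ₀ σ hσ => ?_, AutocorrTest.size_eq_one hX ha hu h𝔠 heN hC hμ h⟩
    rw [AutocorrTest.stat_add_null_eq hX heN hμ hμ₀] at h
    exact AutocorrTest.iSup_gaussianLaw_eq_one hX ha hu h𝔠 heN hC hμ₀ hσ h
  · rintro ⟨μ, hμ, h⟩ μ' hμ'
    rwa [← AutocorrTest.stat_add_null_eq hX heN hμ hμ']
  · intro h
    obtain ⟨μ, hμ⟩ := AutocorrTest.nullMeans_nonempty (X := X) (r := r) hR
    exact ⟨μ, hμ, h μ hμ⟩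
  · rintro ⟨μ, hμ, h⟩
    refine ⟨fun μ₀ hμ₀ σ hσ => ?_, fun σ hσ => ?_, ?_, fun μ₁ _ => ?_, ?_⟩
    · rw [AutocorrTest.stat_add_null_eq hX heN hμ hμ₀] at h
      exact AutocorrTest.iInf_gaussianLaw_eq_zero hX ha hu h𝔠 heN hC hμ₀ hσ h
    · exact AutocorrTest.iInf_altMeans_gaussianLaw_eq_zero hX hR hq ha hu h𝔠 heN hC hμ hσ h
    · exact AutocorrTest.isBiased_rejRegion hX hR hq ha hu h𝔠 heN hC hμ h
    · exact AutocorrTest.iInf_sigma_gaussianLaw_eq_zero hX ha hu h𝔠 heN hC hμ h μ₁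
    · exact AutocorrTest.infPower_eq_zero hX hR hq ha hu h𝔠 heN hC hμ h
  · intro heX hRe
    set δ := AutocorrTest.betaHat X e with hδdef
    have hδ : e = X *ᵥ δ := by
      obtain ⟨β, hβ⟩ := heX
      have := AutocorrTest.resid_mulVec hX β
      rw [← hβ] at this
      exact sub_eq_zero.1 this
    -- K is the standard normal probability of this set, whose definition involves none of r, C, the
    -- covariance model, μ₀, σ and M.
    set A := AutocorrTest.dominantSet κ X R a₁ a₂ e δ with hA
    have hK : ((AutocorrTest.stdNormal n A).toNNReal : ℝ≥0∞) = AutocorrTest.stdNormal n A :=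
      ENNReal.coe_toNNReal (measure_ne_top _ _)
    refine ⟨(AutocorrTest.stdNormal n A).toNNReal, fun hYW => ?_, ?_⟩
    · rw [hA, AutocorrTest.stdNormal_dominantSet_eq_one hX hR ha hu hδ hRe hYW]
      rfl
    · intro r 𝔠 C _ h𝔠 hC μ₀ hμ₀
      rw [hK]
      refine ⟨fun γ hγ => ?_, fun σ hσ => ⟨fun M _ => ?_, ?_, fun hYW => ?_⟩⟩
      · have := AutocorrTest.add_smul_mem_altMeans hX hμ₀ hRe hγ
        rwa [← hδ] at this
      · exact AutocorrTest.iInf_le_stdNormal_dominantSet hX hR ha hu hδ hRe h𝔠 hC hμ₀ hσ M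
      · exact AutocorrTest.stdNormal_dominantSet_le_iSup hX hR ha hu hδ hRe h𝔠 hC hμ₀ hσ
      · refine le_antisymm (iSup₂_le fun S _ => prob_le_one) ?_
        rw [← AutocorrTest.stdNormal_dominantSet_eq_one (κ := κ) hX hR ha hu hδ hRe hYW]
        exact AutocorrTest.stdNormal_dominantSet_le_iSup hX hR ha hu hδ hRe h𝔠 hC hμ₀ hσ
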